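/- Let $Q\ge 2$ be an integer. Consider the V-BLAST system with $Q^2$-QAM, $M\ge 1$ transmit and $N\ge M$ receive antennas over a flat Rayleigh fading channel, $$\mathbf r^c=\sqrt{\tfrac{\rho}{M}}\;\mathbf H^c\mathbf c^c+\mathbf z^c ,$$ where $\mathbf H^c\in\mathbb C^{N\times M}$ and $\mathbf z^c\in\mathbb C^N$ have i.i.d. $\mathcal N_{\mathbb C}(0,1)$ entries, the components of $\mathbf c^c$ are independent and uniform on the centred unit-energy $Q^2$-QAM constellation, $\mathbf H^c,\mathbf z^c,\mathbf c^c$ are independent, and $\rho>0$ is the SNR. Put $m=2M$, $n=2N$, $r=n-m\ge 0$. With $\mathbf u^c\mapsto[\Re\mathbf u^c;\Im\mathbf u^c]$, $\mathbf A^c\mapsto\begin{pmatrix}\Re \mathbf A^c&-\Im \mathbf A^c\\ \Im \mathbf A^c&\Re \mathbf A^c\end{pmatrix}$ and multiplication by $\sqrt2$, this becomes a real system $\mathbf r=\mathbf H(\kappa\mathbf x+\mathbf v)+\mathbf z$ with $\mathbf x\in\{0,\dots,Q-1\}^m$, $\kappa=\sqrt{6/(Q^2-1)}$, constant offset vector $\mathbf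 v$ (all entries equal to $-\kappa(Q-1)/2$) and $\mathbf z\sim\mathcal N(0,\mathbf I)$. Let $\kappa\mathbf H=\mathbf Q\mathbf R$ be the thin QR decomposition (zero-forcing preprocessing) and $\mathbf y=\mathbf Q^{T}(\mathbf r-\mathbf H\mathbf v)$, and number the components of $\mathbf y$, of $\mathbf x$ and of the rows and columns of $\mathbf R$ in reverse order. For a node $\mathbf x_1^k=(x_1,\dots,x_k)\in\{0,\dots,Q-1\}^k$, $0\le k\le m$, of the $Q$-ary tree of depth $m$, and a bias $b>0$, put $$h(\mathbf x_1^k)=\sum_{i=1}^k\Big|y_i-\sum_{j=1}^i r_{i,j}x_j\Big|^2-bk .$$ The stack algorithm keeps a list ACTIVE, initially containing only the root. The cost of a leaf ($k=m$) in ACTIVE is $-\infty$, and the cost of any other node in ACTIVE is the value of $h$ at its best (least $h$) child not generated yet. At each step the list is sorted in ascending order of cost; if its top node is a leaf, the search stops; if all children of the top node have been generated, that node is removed; otherwise its best child not generated yet is generated and placed in ACTIVE. The complexity is the number of nodes that are in ACTIVE at some instant, and $mC_m$ denotes its expectation over the channel, the noise and the transmitted vector, so that $C_m$ is the average complexity per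 dimension. Then there is $b_0=b_0(Q)>0$ such that for every bias $b\ge b_0$ there are constants $\eta_0>0$ and $C>0$, depending only on $Q$ and $b$, such that $$C_m\le C\qquad\text{for all } M\ge 1,\ N\ge M\ \text{and all } \rho\ge\eta_0 m .$$ That is, if the SNR grows linearly with $m$, with $\rho/m$ above a threshold, the average complexity per dimension of the stack algorithm is bounded by a constant, and its total average complexity grows at most linearly in $m$. -/

import Mathlib

open MeasureTheory ProbabilityTheory
open scoped ENNReal

noncomputable section

/-! ### The V-BLAST system -/

/-- The circularly symmetric complex Gaussian law with mean `0` and variance `1`: independent real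
and imaginary parts, each centred Gaussian with variance `1/2`. -/
def stdComplexGaussian : Measure ℂ :=
  ((gaussianReal 0 (1 / 2)).prod (gaussianReal 0 (1 / 2))).map (fun p : ℝ × ℝ => ⟨p.1, p.2⟩)

/-- Law of the complex channel matrix: i.i.d. standard complex Gaussian entries. -/
def channelLaw (N M : ℕ) : Measure (Fin N → Fin M → ℂ) :=
  Measure.pi fun _ => Measure.pi fun _ => stdComplexGaussian

/-- Law of the complex noise vector: i.i.d. standard complex Gaussian entries. -/
def noiseLaw (N : ℕ) : Measure (Fin N → ℂ) :=
  Measure.pi fun _ => stdComplexGaussian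

/-- The information vector is uniform on `{0, …, Q-1}^m`. -/
def symbolLaw (Q m : ℕ) : Measure (Fin m → Fin Q) :=
  uniformOn Set.univ

/-- Channel, noise and information vector are independent. The real dimension is `m = M + M`. -/
def systemLaw (Q M N : ℕ) :
    Measure ((Fin N → Fin M → ℂ) × (Fin N → ℂ) × (Fin (M + M) → Fin Q)) :=
  (channelLaw N M).prod ((noiseLaw N).prod (symbolLaw Q (M + M)))

/-- The distance between neighbouring points of the unit-energy `Q²`-QAM constellation. -/
def qamScale (Q : ℕ) : ℝ := √(6 / ((Q : ℝ) ^ 2 - 1))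

/-- The offset centring `Q`-PAM: `qamScale Q * {0, …, Q-1} + qamOffset Q` is symmetric about `0`. -/
def qamOffset (Q : ℕ) : ℝ := -(qamScale Q * ((Q : ℝ) - 1) / 2)

/-- The point of the `Q²`-QAM constellation with labels `a` (real part), `b` (imaginary part). -/
def qamPoint (Q : ℕ) (a b : Fin Q) : ℂ :=
  ⟨qamScale Q * (a : ℕ) + qamOffset Q, qamScale Q * (b : ℕ) + qamOffset Q⟩

/-- The transmitted complex vector. The information vector lists the labels of all real parts
first and those of all imaginary parts after them. -/
def transmitted {Q M : ℕ} (x : Fin (M + M) → Fin Q) : Fin M → ℂ :=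
  fun i => qamPoint Q (x (Fin.castAdd M i)) (x (Fin.natAdd M i))

/-- The received complex vector `√(ρ/M) Hᶜ cᶜ + zᶜ`. -/
def received {Q M N : ℕ} (ρ : ℝ) (Hc : Fin N → Fin M → ℂ) (zc : Fin N → ℂ)
    (x : Fin (M + M) → Fin Q) : Fin N → ℂ :=
  fun i => ((√(ρ / M) : ℝ) : ℂ) * ∑ j, Hc i j * transmitted x j + zc i

/-- `u ↦ [Re u; Im u]`. -/
def realVec {k : ℕ} (u : Fin k → ℂ) : Fin (k + k) → ℝ :=
  Fin.append (fun i => (u i).re) (fun i => (u i).im)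

/-- `A ↦ [[Re A, -Im A], [Im A, Re A]]`. -/
def realMat {N M : ℕ} (A : Fin N → Fin M → ℂ) : Matrix (Fin (N + N)) (Fin (M + M)) ℝ :=
  (Matrix.fromBlocks
    (Matrix.of fun i j => (A i j).re) (-Matrix.of fun i j => (A i j).im)
    (Matrix.of fun i j => (A i j).im) (Matrix.of fun i j => (A i j).re)).reindex
    finSumFinEquiv finSumFinEquiv

/-- The real channel matrix `H`. The real model is the complex one multiplied by `√2`, so that the
real noise has unit variance in each component. -/
def realChannel {N M : ℕ} (ρ : ℝ) (Hc : Fin N → Fin M → ℂ) :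
    Matrix (Fin (N + N)) (Fin (M + M)) ℝ :=
  (√2 * √(ρ / M)) • realMat Hc

/-- The combined channel and code matrix `H G`, with `G = qamScale Q • 1`. -/
def combinedMatrix {N M : ℕ} (Q : ℕ) (ρ : ℝ) (Hc : Fin N → Fin M → ℂ) :
    Matrix (Fin (N + N)) (Fin (M + M)) ℝ :=
  realChannel ρ Hc * (qamScale Q • (1 : Matrix (Fin (M + M)) (Fin (M + M)) ℝ))

/-- The received real vector after removal of the constellation offset, `r - H v`. -/
def centredReceived {Q M N : ℕ} (ρ : ℝ) (Hc : Fin N → Fin M → ℂ) (zc : Fin N → ℂ)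
    (x : Fin (M + M) → Fin Q) : Fin (N + N) → ℝ :=
  √2 • realVec (received ρ Hc zc x) - (realChannel ρ Hc).mulVec (fun _ => qamOffset Q)

/-! ### Zero-forcing preprocessing: QR decomposition -/

/-- The columns of the orthonormal factor in the thin QR decomposition `B = Q R`. -/
def qrColumn {n m : ℕ} (B : Matrix (Fin n) (Fin m) ℝ) (i : Fin m) : EuclideanSpace ℝ (Fin n) :=
  InnerProductSpace.gramSchmidtNormed ℝ (fun j => WithLp.toLp 2 (fun l => B l j)) i

/-- The triangular factor `R = Qᵀ B` with rows and columns numbered in reverse order, so that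
row `k` only involves the columns `j ≤ k`. -/
def treeMatrix {n m : ℕ} (B : Matrix (Fin n) (Fin m) ℝ) : Matrix (Fin m) (Fin m) ℝ :=
  Matrix.of fun k j => inner ℝ (qrColumn B k.rev) (WithLp.toLp 2 (fun l => B l j.rev))

/-- The preprocessed vector `Qᵀ u`, with components numbered in reverse order. -/
def treeVector {n m : ℕ} (B : Matrix (Fin n) (Fin m) ℝ) (u : Fin n → ℝ) : Fin m → ℝ :=
  fun k => inner ℝ (qrColumn B k.rev) (WithLp.toLp 2 u)

/-! ### The search tree -/

/-- A node at level `k` is the list `[x₁, …, x_k]`; the root is the empty list. -/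
abbrev TreeNode (Q : ℕ) : Type := List (Fin Q)

/-- The squared distance attached to the `i`-th edge (`i` counted from `0`) of the path to `p`:
`|y_i - ∑_{j ≤ i} r_{i,j} x_j|²`. -/
def edgeWeight {Q m : ℕ} (R : Matrix (Fin m) (Fin m) ℝ) (y : Fin m → ℝ) (p : TreeNode Q)
    (i : Fin m) : ℝ :=
  (y i - ∑ j ∈ Finset.Iic i, R i j * (p.map fun a => ((a : ℕ) : ℝ)).getD j 0) ^ 2

/-- `h(x₁,…,x_k) = ∑_{i ≤ k} w_i(x₁,…,x_i) - b k`. -/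
def nodeCost {Q m : ℕ} (b : ℝ) (R : Matrix (Fin m) (Fin m) ℝ) (y : Fin m → ℝ)
    (p : TreeNode Q) : ℝ :=
  (∑ i ∈ Finset.univ.filter (fun i : Fin m => (i : ℕ) < p.length), edgeWeight R y p i) - b * p.length

/-! ### The stack algorithm -/

/-- The ordered list ACTIVE and the set of nodes generated so far. -/
structure StackState (Q : ℕ) where
  active : List (TreeNode Q)
  generated : Finset (TreeNode Q)

/-- The labels of the children of `p` that have not been generated yet. -/
def remaining {Q : ℕ} (g : Finset (TreeNode Q)) (p : TreeNode Q) : List (Fin Q) :=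
  (List.finRange Q).filter fun a => p ++ [a] ∉ g

/-- The cost function `f` of a node in ACTIVE: `-∞` for a leaf, otherwise the value of `h` at the
best child not generated yet (`+∞` if all children have been generated). -/
def stackCost {Q : ℕ} (m : ℕ) (h : TreeNode Q → ℝ) (g : Finset (TreeNode Q)) (p : TreeNode Q) :
    EReal :=
  if p.length = m then ⊥ else ⨅ a ∈ remaining g p, ((h (p ++ [a]) : ℝ) : EReal)

open Classical in
/-- One step of the stack algorithm. If the top node of ACTIVE is a leaf, the search terminates. If
all of its children have been generated, it is removed. Otherwise its best child not generated yet
is generated and placed in ACTIVE, and ACTIVE is sorted in ascending order of the updated costs. -/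
def stackStep {Q : ℕ} (m : ℕ) (h : TreeNode Q → ℝ) (s : StackState Q) : StackState Q :=
  match s.active with
  | [] => s
  | p :: rest =>
    if p.length = m then ⟨[], s.generated⟩
    else
      match (remaining s.generated p).argmin fun a => h (p ++ [a]) with
      | none => ⟨rest, s.generated⟩
      | some a =>
        let g := insert (p ++ [a]) s.generated
        ⟨((p ++ [a]) :: p :: rest).insertionSort
          (fun u v => stackCost m h g u ≤ stackCost m h g v), g⟩

/-- The search starts with the root as the only node in ACTIVE. -/
def stackInit (Q : ℕ) : StackState Q := ⟨[[]], {[]}⟩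

/-- The nodes (the root included) that occupy a position in ACTIVE at some instant. -/
def generatedNodes {Q : ℕ} (m : ℕ) (h : TreeNode Q → ℝ) : Set (TreeNode Q) :=
  {p | ∃ t : ℕ, p ∈ ((stackStep m h)^[t] (stackInit Q)).active}

/-- The number of nodes generated by the stack algorithm with bias `b` at SNR `ρ`, for given
channel, noise and information vector. -/
def stackComplexity {Q M N : ℕ} (ρ b : ℝ) (Hc : Fin N → Fin M → ℂ) (zc : Fin N → ℂ)
    (x : Fin (M + M) → Fin Q) : ℕ∞ :=
  let B := combinedMatrix Q ρ Hc
  (generatedNodes (M + M)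
    (nodeCost (Q := Q) b (treeMatrix B) (treeVector B (centredReceived ρ Hc zc x)))).encard

/-- The expected number of nodes generated by the stack algorithm. -/
def expectedComplexity (Q M N : ℕ) (ρ b : ℝ) : ℝ≥0∞ :=
  ∫⁻ ω, (stackComplexity ρ b ω.1 ω.2.1 ω.2.2 : ℝ≥0∞) ∂(systemLaw Q M N)

end

/-!
A node off the transmitted path, branching at level `l` and of length `k`, is generated only if it
costs at most as much as some node at level `j > l` of the transmitted path
(`exists_cost_le_of_mem_generatedNodes`): the search always keeps an entry that leads further down
that path, and it extends the cheapest entry. In the triangular system the labels `x` are sent to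
`y = R x + ζ`, so the comparison of costs involves the noise components `ζ_i` and the distances
`(R d)_i`, where `d` is the vector of label errors. As `(ζ_i + (R d)_i)² ≥ (R d)_i² / 2 - ζ_i²`, it
forces `∑_{i < k} (R d)_i² / 2` to be at most `2 ∑ ζ_i² + b (k - j)`, the second sum being over the
levels from `l` to `max k j`. A Chernoff bound separates the two sources of randomness: averaging
over the noise costs a factor `√2` per level, and the bias `b ≥ 16` makes the sum over `j` geometric
(`lintegral_generationBound_le`). What remains is the average over the channel of
`exp (-∑_{i < k} (R d)_i² / 16)`. If it is at most `const * θ ^ (k - l)` with `θ` small, then `θ`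
beats the factor `Q √2 exp (b / 8)` per level that comes from the number of nodes, the noise and the
bias; hence every branching level contributes a bounded number of nodes on average.

The sum `∑_{i < k} (R d)_i²` is at least the squared distance of `B d` to the span of the first
`m - k` columns of `B`. The columns of the real form of the channel are not independent: each
complex column `h` gives the two real columns `h` and `i h`. Let `h` be the complex column of the
first wrong label. Conditionally on all other complex columns, and projecting onto the orthogonal
complement of the removed real columns other than those from `h`, the distance is at least the
length of the projection of `(w + t u) h`, shifted by a fixed vector, where `w` and `u` are
real-orthogonal complex numbers, `|w| ≥ 1`, `|u| = 1`, and `t` is an unknown real number that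
depends on `h`. The maximum over `t` is dominated by an integral over `t`
(`exp_neg_sum_sq_le_lintegral_line`), at the price of a factor of the size of the projection of
`u h`, which Hölder's inequality with exponents `4` and `4 / 3` absorbs. For fixed `t` the Laplace
transform is at most `(1 + s (|w|² + t²)) ^ (-r / 2)`, where `r` is the dimension projected on and
`s` is proportional to the ratio of the SNR to `m`. As `r ≥ 2`, the result is integrable in `t` and
small for large `s` (`lintegral_column_le`). A dimension count shows that `r = max 2 (k - l)`
dimensions are always left (`lintegral_exp_neg_sum_inner_sq_channelLaw_le`).

No step needs the channel to have full rank: the Gram-Schmidt vectors that vanish for dependent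
columns only drop out of sums of squares.
-/

/-! ### Complex Gaussian vectors -/

instance : IsProbabilityMeasure stdComplexGaussian := by
  unfold stdComplexGaussian
  exact Measure.isProbabilityMeasure_map
    (Complex.measurableEquivRealProd.symm.measurable.aemeasurable)

instance (N : ℕ) : IsProbabilityMeasure (noiseLaw N) := by unfold noiseLaw; infer_instance

instance (N M : ℕ) : IsProbabilityMeasure (channelLaw N M) := by unfold channelLaw; infer_instance

lemma integral_cexp_stdComplexGaussian (a b : ℝ) :
    ∫ z : ℂ, Complex.exp (((a * z.re + b * z.im : ℝ) : ℂ) * Complex.I) ∂stdComplexGaussian =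
      Complex.exp (-((a ^ 2 + b ^ 2 : ℝ) : ℂ) / 4) := by
  have hm : AEMeasurable (fun p : ℝ × ℝ => (⟨p.1, p.2⟩ : ℂ))
      ((gaussianReal 0 (1 / 2)).prod (gaussianReal 0 (1 / 2))) :=
    Complex.measurableEquivRealProd.symm.measurable.aemeasurable
  rw [stdComplexGaussian, integral_map hm (by fun_prop)]
  have h1 := charFun_gaussianReal (μ := 0) (v := 1 / 2) a
  have h2 := charFun_gaussianReal (μ := 0) (v := 1 / 2) b
  rw [charFun_apply_real] at h1 h2
  have : ∀ p : ℝ × ℝ, Complex.exp (((a * p.1 + b * p.2 : ℝ) : ℂ) * Complex.I) =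
      Complex.exp (a * p.1 * Complex.I) * Complex.exp (b * p.2 * Complex.I) := by
    intro p
    rw [← Complex.exp_add]; congr 1; push_cast; ring
  simp only [this]
  rw [integral_prod_mul (fun x : ℝ => Complex.exp (a * x * Complex.I))
    (fun x : ℝ => Complex.exp (b * x * Complex.I)), h1, h2, ← Complex.exp_add]
  congr 1; push_cast; ring

lemma inner_realVec {N : ℕ} (f : EuclideanSpace ℝ (Fin (N + N))) (u : Fin N → ℂ) :
    inner ℝ f (WithLp.toLp 2 (realVec u)) =
      ∑ n, (f (Fin.castAdd N n) * (u n).re + f (Fin.natAdd N n) * (u n).im) := by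
  simp only [PiLp.inner_apply, Fin.sum_univ_add, realVec, Fin.append_left, Fin.append_right,
    ← Finset.sum_add_distrib]
  simp only [RCLike.inner_apply, conj_trivial, mul_comm]

@[fun_prop]
lemma measurable_realVec {k : ℕ} {α : Type*} [MeasurableSpace α] {u : α → Fin k → ℂ}
    (hu : Measurable u) : Measurable fun a => realVec (u a) := by
  refine measurable_pi_lambda _ fun i => ?_
  refine Fin.addCases (fun i => ?_) (fun i => ?_) i
  · simp only [realVec, Fin.append_left]; fun_prop
  · simp only [realVec, Fin.append_right]; fun_prop

/-- Orthonormal coordinates of the real form of `γ z`, for `z` a standard complex Gaussian vector,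
are, up to the factor `√2`, independent centred Gaussians of variance `‖γ‖²`. Multiplication by a
complex number is a similarity, so no relation between the orthonormal family and the complex
structure is needed. -/
lemma map_inner_noiseLaw {N : ℕ} {ι : Type*} [Fintype ι]
    {e : ι → EuclideanSpace ℝ (Fin (N + N))} (he : Orthonormal ℝ e) (γ : ℂ) :
    (noiseLaw N).map
        (fun g i => √2 * inner ℝ (e i) (WithLp.toLp 2 (realVec (fun n => γ * g n)))) =
      Measure.pi (fun _ : ι => gaussianReal 0 (‖γ‖₊ ^ 2)) := by
  have hmeas : Measurable (fun (g : Fin N → ℂ) (i : ι) =>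
      √2 * inner ℝ (e i) (WithLp.toLp 2 (realVec (fun n => γ * g n)))) := by
    refine measurable_pi_lambda _ fun i => ?_
    simp only [inner_realVec]
    fun_prop
  have : IsProbabilityMeasure ((noiseLaw N).map
        (fun g i => √2 * inner ℝ (e i) (WithLp.toLp 2 (realVec (fun n => γ * g n))))) :=
    Measure.isProbabilityMeasure_map hmeas.aemeasurable
  rw [← charFun_eq_pi_iff]
  intro τ
  rw [charFun_apply, integral_map (by fun_prop) (by fun_prop),
    integral_map hmeas.aemeasurable (by fun_prop)]
  set f : EuclideanSpace ℝ (Fin (N + N)) := √2 • ∑ i, τ i • e i with hf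
  have hfn : ∑ n, (f (Fin.castAdd N n) ^ 2 + f (Fin.natAdd N n) ^ 2) = 2 * ∑ i, τ i ^ 2 := by
    have h1 : ‖f‖ ^ 2 = 2 * ∑ i, τ i ^ 2 := by
      rw [hf, norm_smul, mul_pow, Real.norm_eq_abs, sq_abs, Real.sq_sqrt (by norm_num),
        ← real_inner_self_eq_norm_sq, he.inner_sum]
      simp [pow_two]
    rw [← h1, EuclideanSpace.real_norm_sq_eq, Fin.sum_univ_add, Finset.sum_add_distrib]
  have key : ∀ g : Fin N → ℂ, (inner ℝ (WithLp.toLp 2 (fun i =>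
      √2 * inner ℝ (e i) (WithLp.toLp 2 (realVec (fun n => γ * g n))))) τ : ℝ) =
      ∑ n, ((f (Fin.castAdd N n) * γ.re + f (Fin.natAdd N n) * γ.im) * (g n).re +
        (-f (Fin.castAdd N n) * γ.im + f (Fin.natAdd N n) * γ.re) * (g n).im) := by
    intro g
    have h1 : (inner ℝ (WithLp.toLp 2 (fun i =>
      √2 * inner ℝ (e i) (WithLp.toLp 2 (realVec (fun n => γ * g n))))) τ : ℝ) =
      inner ℝ f (WithLp.toLp 2 (realVec (fun n => γ * g n))) := by
      rw [hf, inner_smul_left, sum_inner, PiLp.inner_apply, Finset.mul_sum]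
      refine Finset.sum_congr rfl fun i _ => ?_
      simp only [inner_smul_left]
      simp
      ring
    rw [h1, inner_realVec]
    refine Finset.sum_congr rfl fun n _ => ?_
    simp only [Complex.mul_re, Complex.mul_im]
    ring
  simp only [key]
  rw [noiseLaw]
  have hprod : ∀ g : Fin N → ℂ, Complex.exp (((∑ n,
      ((f (Fin.castAdd N n) * γ.re + f (Fin.natAdd N n) * γ.im) * (g n).re +
        (-f (Fin.castAdd N n) * γ.im + f (Fin.natAdd N n) * γ.re) * (g n).im) : ℝ) : ℂ)
        * Complex.I) = ∏ n, Complex.exp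
          ((((f (Fin.castAdd N n) * γ.re + f (Fin.natAdd N n) * γ.im) * (g n).re +
            (-f (Fin.castAdd N n) * γ.im + f (Fin.natAdd N n) * γ.re) * (g n).im : ℝ) : ℂ) *
              Complex.I) := by
    intro g
    rw [← Complex.exp_sum]; push_cast; rw [Finset.sum_mul]
  simp only [hprod]
  rw [integral_fintype_prod_eq_prod (f := fun (n : Fin N) (z : ℂ) =>
    Complex.exp ((((f (Fin.castAdd N n) * γ.re + f (Fin.natAdd N n) * γ.im) * z.re +
        (-f (Fin.castAdd N n) * γ.im + f (Fin.natAdd N n) * γ.re) * z.im : ℝ) : ℂ) * Complex.I))]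
  simp only [integral_cexp_stdComplexGaussian, charFun_gaussianReal]
  rw [← Complex.exp_sum, ← Complex.exp_sum]
  congr 1
  have hγ : γ.re ^ 2 + γ.im ^ 2 = ‖γ‖ ^ 2 := by
    rw [← Complex.normSq_eq_norm_sq, Complex.normSq_apply]; ring
  have e1 : ∑ n, ((f (Fin.castAdd N n) * γ.re + f (Fin.natAdd N n) * γ.im) ^ 2 +
        (-f (Fin.castAdd N n) * γ.im + f (Fin.natAdd N n) * γ.re) ^ 2) =
        ‖γ‖ ^ 2 * (2 * ∑ i, τ i ^ 2) := by
    rw [← hfn, ← hγ, Finset.mul_sum]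
    refine Finset.sum_congr rfl fun n _ => by ring
  have e2 : ∀ X : Fin N → ℝ, ∑ n, -((X n : ℝ) : ℂ) / 4 = ((-(∑ n, X n) / 4 : ℝ) : ℂ) := by
    intro X
    push_cast
    rw [← Finset.sum_neg_distrib, Finset.sum_div]
  rw [e2, e1]
  push_cast
  simp only [mul_zero, zero_mul, zero_sub, Finset.sum_neg_distrib, ← Finset.sum_div,
    ← Finset.mul_sum]
  ring

lemma lintegral_pi_prod {ι : Type*} [Fintype ι] {Ω : ι → Type*} [∀ i, MeasurableSpace (Ω i)]
    (μ : ∀ i, Measure (Ω i)) [∀ i, IsProbabilityMeasure (μ i)] (f : ∀ i, Ω i → ℝ≥0∞)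
    (hf : ∀ i, Measurable (f i)) :
    ∫⁻ x, ∏ i, f i (x i) ∂Measure.pi μ = ∏ i, ∫⁻ x, f i x ∂μ i := by
  have hind : iIndepFun (fun i (x : ∀ i, Ω i) => f i (x i)) (Measure.pi μ) :=
    iIndepFun_pi (fun i => (hf i).aemeasurable)
  rw [lintegral_prod_eq_prod_lintegral_of_indepFun _ _ hind (fun i => by fun_prop)]
  refine Finset.prod_congr rfl fun i _ => ?_
  exact (measurePreserving_eval μ i).lintegral_comp (hf i)

lemma lintegral_ofReal_exp_neg_mul_add_sq {β : ℝ} (hβ : 0 < β) (d : ℝ) :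
    ∫⁻ x : ℝ, ENNReal.ofReal (Real.exp (-β * (x + d) ^ 2)) = ENNReal.ofReal √(Real.pi / β) := by
  rw [lintegral_add_right_eq_self (fun x : ℝ => ENNReal.ofReal (Real.exp (-β * x ^ 2))) d,
    ← ofReal_integral_eq_lintegral_ofReal (integrable_exp_neg_mul_sq hβ)
      (Filter.Eventually.of_forall fun x => (Real.exp_pos _).le), integral_gaussian]

lemma lintegral_gaussianReal_eq {v : NNReal} (hv : v ≠ 0) (f : ℝ → ℝ) (hf : Measurable f) :
    ∫⁻ x, ENNReal.ofReal (Real.exp (f x)) ∂gaussianReal 0 v =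
      ENNReal.ofReal (√(2 * Real.pi * v))⁻¹ *
        ∫⁻ x, ENNReal.ofReal (Real.exp (-x ^ 2 / (2 * v) + f x)) := by
  rw [gaussianReal_of_var_ne_zero _ hv, lintegral_withDensity_eq_lintegral_mul _ (by fun_prop)
    (by fun_prop), ← lintegral_const_mul _ (by fun_prop)]
  refine lintegral_congr fun x => ?_
  simp only [Pi.mul_apply, gaussianPDF, gaussianPDFReal, sub_zero]
  rw [ENNReal.ofReal_mul (by positivity), mul_assoc, Real.exp_add,
    ENNReal.ofReal_mul (Real.exp_pos _).le]

lemma lintegral_exp_neg_mul_add_sq_gaussianReal_le {v : NNReal} (hv : v ≠ 0) {s : ℝ} (hs : 0 ≤ s)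
    (c : ℝ) :
    ∫⁻ x, ENNReal.ofReal (Real.exp (-s * (x + c) ^ 2)) ∂gaussianReal 0 v ≤
      ENNReal.ofReal (√(1 + 2 * s * v))⁻¹ := by
  have hv' : (0 : ℝ) < v := by positivity
  have hβ : 0 < s + 1 / (2 * (v : ℝ)) := by positivity
  rw [lintegral_gaussianReal_eq hv _ (by fun_prop)]
  calc _ ≤ ENNReal.ofReal (√(2 * Real.pi * v))⁻¹ * ∫⁻ x : ℝ, ENNReal.ofReal
        (Real.exp (-(s + 1 / (2 * (v : ℝ))) * (x + s * c / (s + 1 / (2 * (v : ℝ)))) ^ 2)) := by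
        gcongr with x
        -- completing the square only discards the non-positive constant `-s c² + (s c)² / β`
        set β := s + 1 / (2 * (v : ℝ)) with hb
        have h1 : -x ^ 2 / (2 * v) + -s * (x + c) ^ 2 =
            -β * (x + s * c / β) ^ 2 - s * c ^ 2 * (1 - s / β) := by
          have : -x ^ 2 / (2 * v) = -(β - s) * x ^ 2 := by rw [hb]; ring
          rw [this]; field_simp; ring
        have h2 : s / β ≤ 1 := (div_le_one hβ).2 (by
          rw [hb]
          have := one_div_pos.2 (by positivity : 0 < 2 * (v : ℝ))
          linarith)
        have h3 : 0 ≤ s * c ^ 2 * (1 - s / β) := by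
          have := sub_nonneg.2 h2
          positivity
        linarith
    _ = _ := by
        rw [lintegral_ofReal_exp_neg_mul_add_sq hβ, ← ENNReal.ofReal_mul (by positivity)]
        congr 1
        rw [← Real.sqrt_inv, ← Real.sqrt_mul (by positivity), ← Real.sqrt_inv]
        congr 1
        field_simp
        ring

lemma lintegral_exp_sq_div_four_gaussianReal :
    ∫⁻ x, ENNReal.ofReal (Real.exp (x ^ 2 / 4)) ∂gaussianReal 0 1 = ENNReal.ofReal √2 := by
  rw [lintegral_gaussianReal_eq one_ne_zero _ (by fun_prop)]
  have h := lintegral_ofReal_exp_neg_mul_add_sq (β := 1 / 4) (by norm_num) 0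
  have : ∀ x : ℝ, -x ^ 2 / (2 * ((1 : NNReal) : ℝ)) + x ^ 2 / 4 = -(1 / 4) * (x + 0) ^ 2 := by
    intro x; push_cast; ring
  simp only [this]
  rw [h, ← ENNReal.ofReal_mul (by positivity)]
  congr 1
  rw [← Real.sqrt_inv, ← Real.sqrt_mul (by positivity)]
  congr 1
  push_cast
  field_simp
  norm_num

/-- Laplace transform of a shifted Gaussian sum of squares. The shift can only make it smaller. -/
lemma lintegral_exp_neg_sum_sq_noiseLaw_le {N : ℕ} {ι : Type*} [Fintype ι]
    {e : ι → EuclideanSpace ℝ (Fin (N + N))} (he : Orthonormal ℝ e) {γ : ℂ} (hγ : γ ≠ 0)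
    {s : ℝ} (hs : 0 ≤ s) (c : ι → ℝ) :
    ∫⁻ g, ENNReal.ofReal (Real.exp (-s * ∑ i,
        (inner ℝ (e i) (WithLp.toLp 2 (realVec (fun n => γ * g n))) + c i) ^ 2)) ∂noiseLaw N ≤
      ENNReal.ofReal (√(1 + s * ‖γ‖ ^ 2))⁻¹ ^ Fintype.card ι := by
  have hmeas : Measurable (fun (g : Fin N → ℂ) (i : ι) =>
      √2 * inner ℝ (e i) (WithLp.toLp 2 (realVec (fun n => γ * g n)))) := by
    refine measurable_pi_lambda _ fun i => ?_
    simp only [inner_realVec]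
    fun_prop
  have h1 : ∀ g : Fin N → ℂ, ENNReal.ofReal (Real.exp (-s * ∑ i,
        (inner ℝ (e i) (WithLp.toLp 2 (realVec (fun n => γ * g n))) + c i) ^ 2)) =
      (fun x : ι → ℝ => ∏ i, ENNReal.ofReal (Real.exp (-(s / 2) * (x i + √2 * c i) ^ 2)))
        (fun i => √2 * inner ℝ (e i) (WithLp.toLp 2 (realVec (fun n => γ * g n)))) := by
    intro g
    simp only
    rw [← ENNReal.ofReal_prod_of_nonneg (fun i _ => (Real.exp_pos _).le), ← Real.exp_sum,
      Finset.mul_sum]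
    congr 3 with i
    rw [← mul_add, mul_pow, Real.sq_sqrt (by norm_num)]
    ring
  simp only [h1]
  have hv : ‖γ‖₊ ^ 2 ≠ 0 := pow_ne_zero _ (nnnorm_ne_zero_iff.2 hγ)
  rw [← lintegral_map (f := fun x : ι → ℝ =>
      ∏ i, ENNReal.ofReal (Real.exp (-(s / 2) * (x i + √2 * c i) ^ 2)))
    (by fun_prop) hmeas, map_inner_noiseLaw he,
    lintegral_pi_prod (fun _ => gaussianReal 0 (‖γ‖₊ ^ 2))
    (fun i x => ENNReal.ofReal (Real.exp (-(s / 2) * (x + √2 * c i) ^ 2))) (by fun_prop)]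
  refine (Finset.prod_le_prod' fun i _ =>
    lintegral_exp_neg_mul_add_sq_gaussianReal_le hv (by positivity) _).trans ?_
  rw [Finset.prod_const, Finset.card_univ]
  refine le_of_eq ?_
  congr 5
  push_cast
  ring

lemma lintegral_exp_sum_sq_noiseLaw {N : ℕ} {ι : Type*} [Fintype ι]
    {e : ι → EuclideanSpace ℝ (Fin (N + N))} (he : Orthonormal ℝ e) {γ : ℂ} (hγ : ‖γ‖ = 1) :
    ∫⁻ g, ENNReal.ofReal (Real.exp ((∑ i,
        (inner ℝ (e i) (WithLp.toLp 2 (realVec (fun n => γ * g n)))) ^ 2) / 2)) ∂noiseLaw N =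
      ENNReal.ofReal √2 ^ Fintype.card ι := by
  have hmeas : Measurable (fun (g : Fin N → ℂ) (i : ι) =>
      √2 * inner ℝ (e i) (WithLp.toLp 2 (realVec (fun n => γ * g n)))) := by
    refine measurable_pi_lambda _ fun i => ?_
    simp only [inner_realVec]
    fun_prop
  have h1 : ∀ g : Fin N → ℂ, ENNReal.ofReal (Real.exp ((∑ i,
        (inner ℝ (e i) (WithLp.toLp 2 (realVec (fun n => γ * g n)))) ^ 2) / 2)) =
      (fun x : ι → ℝ => ∏ i, ENNReal.ofReal (Real.exp ((x i) ^ 2 / 4)))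
        (fun i => √2 * inner ℝ (e i) (WithLp.toLp 2 (realVec (fun n => γ * g n)))) := by
    intro g
    simp only
    rw [← ENNReal.ofReal_prod_of_nonneg (fun i _ => (Real.exp_pos _).le), ← Real.exp_sum,
      Finset.sum_div]
    congr 3 with i
    rw [mul_pow, Real.sq_sqrt (by norm_num)]
    ring
  have hv : ‖γ‖₊ = 1 := by ext; simpa using hγ
  simp only [h1]
  rw [← lintegral_map (f := fun x : ι → ℝ => ∏ i, ENNReal.ofReal (Real.exp ((x i) ^ 2 / 4)))
    (by fun_prop) hmeas, map_inner_noiseLaw he, hv, one_pow,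
    lintegral_pi_prod (fun _ => gaussianReal 0 1)
    (fun i x => ENNReal.ofReal (Real.exp (x ^ 2 / 4))) (by fun_prop)]
  simp [lintegral_exp_sq_div_four_gaussianReal]

/-! ### One complex column of the channel -/

/-- A Gaussian profile along a line dominates, after integration along the line, its value at any
single point of the line. It replaces a minimum over an unknown real coefficient by an integral. -/
lemma exp_neg_sum_sq_le_lintegral_line {ι : Type*} [Fintype ι] (A b : ι → ℝ) {s : ℝ} (hs : 0 ≤ s)
    (t₀ : ℝ) :
    ENNReal.ofReal (Real.exp (-(2 * s) * ∑ i, A i ^ 2)) ≤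
      ENNReal.ofReal (Real.exp 2 / 2) * ENNReal.ofReal (1 + √s * √(∑ i, b i ^ 2)) *
        ∫⁻ t, ENNReal.ofReal (Real.exp (-s * ∑ i, (A i + (t - t₀) * b i) ^ 2)) := by
  set D := 1 + √s * √(∑ i, b i ^ 2) with hD
  have hD1 : 1 ≤ D := by rw [hD]; have : 0 ≤ √s * √(∑ i, b i ^ 2) := by positivity
                         linarith
  have hD0 : 0 < D := by linarith
  have hlow : ENNReal.ofReal (Real.exp (-(2 * s) * ∑ i, A i ^ 2) * Real.exp (-2)) *
      ENNReal.ofReal (2 / D) ≤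
      ∫⁻ t, ENNReal.ofReal (Real.exp (-s * ∑ i, (A i + (t - t₀) * b i) ^ 2)) := by
    calc _ = ∫⁻ _t in Set.Icc (t₀ - 1 / D) (t₀ + 1 / D),
          ENNReal.ofReal (Real.exp (-(2 * s) * ∑ i, A i ^ 2) * Real.exp (-2)) := by
          rw [setLIntegral_const, Real.volume_Icc]
          congr 2; ring
      _ ≤ ∫⁻ t in Set.Icc (t₀ - 1 / D) (t₀ + 1 / D),
          ENNReal.ofReal (Real.exp (-s * ∑ i, (A i + (t - t₀) * b i) ^ 2)) := by
          refine setLIntegral_mono (by fun_prop) fun t ht => ENNReal.ofReal_le_ofReal ?_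
          rw [← Real.exp_add]
          refine Real.exp_le_exp.2 ?_
          have h1 : ∑ i, (A i + (t - t₀) * b i) ^ 2 ≤
              2 * ∑ i, A i ^ 2 + 2 * ((t - t₀) ^ 2 * ∑ i, b i ^ 2) := by
            rw [Finset.mul_sum, Finset.mul_sum, Finset.mul_sum, ← Finset.sum_add_distrib]
            refine Finset.sum_le_sum fun i _ => ?_
            nlinarith [sq_nonneg (A i - (t - t₀) * b i)]
          have h2 : |t - t₀| ≤ 1 / D := abs_le.2 ⟨by linarith [ht.1], by linarith [ht.2]⟩
          have h3 : |t - t₀| * (√s * √(∑ i, b i ^ 2)) ≤ 1 := by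
            calc _ ≤ 1 / D * D := by
                  gcongr
                  rw [hD]; linarith
              _ = 1 := by field_simp
          have h4 : s * ((t - t₀) ^ 2 * ∑ i, b i ^ 2) ≤ 1 := by
            have h5 : (|t - t₀| * (√s * √(∑ i, b i ^ 2))) ^ 2 ≤ 1 :=
              pow_le_one₀ (by positivity) h3
            rw [mul_pow, mul_pow, sq_abs, Real.sq_sqrt hs,
              Real.sq_sqrt (Finset.sum_nonneg fun i _ => sq_nonneg _)] at h5
            linarith
          nlinarith
      _ ≤ _ := setLIntegral_le_lintegral _ _
  calc _ = ENNReal.ofReal (Real.exp 2 / 2) * ENNReal.ofReal D *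
        (ENNReal.ofReal (Real.exp (-(2 * s) * ∑ i, A i ^ 2) * Real.exp (-2)) *
      ENNReal.ofReal (2 / D)) := by
        rw [← ENNReal.ofReal_mul (by positivity), ← ENNReal.ofReal_mul (by positivity),
          ← ENNReal.ofReal_mul (by positivity)]
        congr 1
        rw [Real.exp_neg 2]
        field_simp
    _ ≤ _ := by gcongr

lemma integrable_one_add_sq_rpow :
    Integrable (fun t : ℝ => (1 + t ^ 2) ^ (-(3 / 4) : ℝ)) := by
  have h := integrable_rpow_neg_one_add_norm_sq (E := ℝ) (μ := volume) (r := 3 / 2)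
    (by simp; norm_num)
  refine h.congr (Filter.Eventually.of_forall fun t => ?_)
  simp only [Real.norm_eq_abs, sq_abs]
  norm_num

/-- The constant in the bound for one complex column of the channel. -/
noncomputable def columnConst : ℝ := 3 * Real.exp 2 * ∫ t : ℝ, (1 + t ^ 2) ^ (-(3 / 4) : ℝ)

lemma columnConst_nonneg : 0 ≤ columnConst := by
  unfold columnConst
  have : 0 ≤ ∫ t : ℝ, (1 + t ^ 2) ^ (-(3 / 4) : ℝ) := integral_nonneg fun t => by positivity
  positivity

lemma one_add_pow_four_le (y : ℝ) : (1 + y) ^ 4 ≤ 72 * Real.exp (y ^ 2 / 2) := by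
  have h1 := Real.quadratic_le_exp_of_nonneg (x := y ^ 2 / 2) (by positivity)
  nlinarith [sq_nonneg (y - 1), sq_nonneg (y ^ 2 - 1), sq_nonneg (y + 1),
    sq_nonneg (y ^ 2 - y), sq_nonneg (y ^ 2)]

/-- The complex column `g` enters with the coefficient `w + t u`, where `w` is known, `‖u‖ = 1` and
the real number `t` may depend on `g` in an arbitrary way. -/
lemma lintegral_column_le {N : ℕ} {ι : Type*} [Fintype ι]
    {e : ι → EuclideanSpace ℝ (Fin (N + N))} (he : Orthonormal ℝ e) {u w : ℂ} (hu : ‖u‖ = 1)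
    (hw : ∀ t : ℝ, 1 + t ^ 2 ≤ ‖w + t * u‖ ^ 2) {s : ℝ} (hs : 1 ≤ s) (c : ι → ℝ) (k : ℕ)
    (hι : Fintype.card ι = max 2 k) (F : (Fin N → ℂ) → ℝ≥0∞)
    (hF : ∀ g, ∃ t : ℝ, F g ≤ ENNReal.ofReal (Real.exp (-(2 * s) * ∑ i,
        (inner ℝ (e i) (WithLp.toLp 2 (realVec (fun n => (w + t * u) * g n))) + c i) ^ 2))) :
    ∫⁻ g, F g ∂noiseLaw N ≤ ENNReal.ofReal (columnConst * ((2 / s) ^ (1 / 8 : ℝ)) ^ k) := by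
  have hs0 : 0 < s := by linarith
  set b : (Fin N → ℂ) → ℝ := fun g => ∑ i,
    (inner ℝ (e i) (WithLp.toLp 2 (realVec (fun n => u * g n)))) ^ 2 with hb
  set q : (Fin N → ℂ) → ℝ → ℝ := fun g t => ∑ i,
    (inner ℝ (e i) (WithLp.toLp 2 (realVec (fun n => (w + t * u) * g n))) + c i) ^ 2 with hq
  have hbm : Measurable b := by
    simp only [hb, inner_realVec]; fun_prop
  have hqm : Measurable (fun p : (Fin N → ℂ) × ℝ => q p.1 p.2) := by
    simp only [hq, inner_realVec]; fun_prop
  have hlin : ∀ (g : Fin N → ℂ) (t₀ t : ℝ) (i : ι),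
      inner ℝ (e i) (WithLp.toLp 2 (realVec (fun n => (w + t * u) * g n))) + c i =
      (inner ℝ (e i) (WithLp.toLp 2 (realVec (fun n => (w + t₀ * u) * g n))) + c i) +
        (t - t₀) * inner ℝ (e i) (WithLp.toLp 2 (realVec (fun n => u * g n))) := by
    intro g t₀ t i
    simp only [inner_realVec, Finset.mul_sum]
    rw [add_right_comm, ← Finset.sum_add_distrib]
    congr 1
    refine Finset.sum_congr rfl fun n _ => ?_
    simp
    ring
  have hpt : ∀ g, F g ≤ ∫⁻ t, ENNReal.ofReal (Real.exp 2 / 2) *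
      (ENNReal.ofReal (1 + √s * √(b g)) * ENNReal.ofReal (Real.exp (-s * q g t))) := by
    intro g
    obtain ⟨t₀, h₀⟩ := hF g
    refine h₀.trans ((exp_neg_sum_sq_le_lintegral_line _
      (fun i => inner ℝ (e i) (WithLp.toLp 2 (realVec (fun n => u * g n)))) hs0.le t₀).trans
      (le_of_eq ?_))
    simp only [← hlin]
    rw [lintegral_const_mul _ (by fun_prop), lintegral_const_mul _ (by fun_prop), ← mul_assoc]
  have hb4 : ∫⁻ g, ENNReal.ofReal (1 + √s * √(b g)) ^ (4 : ℝ) ∂noiseLaw N ≤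
      ENNReal.ofReal (72 * s ^ 2 * √2 ^ Fintype.card ι) := by
    calc _ ≤ ∫⁻ g, ENNReal.ofReal (72 * s ^ 2) *
            ENNReal.ofReal (Real.exp (b g / 2)) ∂noiseLaw N := by
          gcongr with g
          rw [ENNReal.ofReal_rpow_of_nonneg (by positivity) (by norm_num),
            ← ENNReal.ofReal_mul (by positivity)]
          refine ENNReal.ofReal_le_ofReal ?_
          have hbn : 0 ≤ b g := Finset.sum_nonneg fun i _ => sq_nonneg _
          have h1 := one_add_pow_four_le √(b g)
          rw [Real.sq_sqrt hbn] at h1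
          have h2 : 1 + √s * √(b g) ≤ √s * (1 + √(b g)) := by
            have : 1 ≤ √s := Real.one_le_sqrt.2 hs
            linarith
          calc (1 + √s * √(b g)) ^ (4 : ℝ) = (1 + √s * √(b g)) ^ (4 : ℕ) := by
                exact_mod_cast Real.rpow_natCast _ 4
            _ ≤ (√s * (1 + √(b g))) ^ 4 := by gcongr
            _ = s ^ 2 * (1 + √(b g)) ^ 4 := by
                rw [mul_pow]; congr 1
                rw [show (4 : ℕ) = 2 * 2 from rfl, pow_mul, Real.sq_sqrt hs0.le]
            _ ≤ s ^ 2 * (72 * Real.exp (b g / 2)) := by gcongr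
            _ = _ := by ring
      _ = _ := by
          rw [lintegral_const_mul _ (by fun_prop), lintegral_exp_sum_sq_noiseLaw he hu,
            ← ENNReal.ofReal_pow (by positivity), ← ENNReal.ofReal_mul (by positivity)]
  have hq43 : ∀ t : ℝ, ∫⁻ g, ENNReal.ofReal (Real.exp (-s * q g t)) ^ (4 / 3 : ℝ) ∂noiseLaw N ≤
      ENNReal.ofReal ((s * (1 + t ^ 2)) ^ (-(Fintype.card ι / 2 : ℝ))) := by
    intro t
    have hne : w + t * u ≠ 0 := by
      intro h
      have := hw t
      rw [h] at this
      norm_num at this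
      nlinarith [sq_nonneg t]
    calc _ ≤ ∫⁻ g, ENNReal.ofReal (Real.exp (-s * q g t)) ∂noiseLaw N := by
          gcongr with g
          rw [ENNReal.ofReal_rpow_of_nonneg (Real.exp_pos _).le (by norm_num), ← Real.exp_mul]
          refine ENNReal.ofReal_le_ofReal (Real.exp_le_exp.2 ?_)
          have : 0 ≤ s * q g t := mul_nonneg hs0.le (Finset.sum_nonneg fun i _ => sq_nonneg _)
          linarith
      _ ≤ _ := lintegral_exp_neg_sum_sq_noiseLaw_le he hne hs0.le c
      _ ≤ _ := by
          rw [← ENNReal.ofReal_pow (by positivity)]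
          refine ENNReal.ofReal_le_ofReal ?_
          rw [Real.rpow_neg (by positivity), inv_pow]
          have h1 : (s * (1 + t ^ 2)) ^ ((Fintype.card ι : ℝ) / 2) =
              √(s * (1 + t ^ 2)) ^ Fintype.card ι := by
            rw [Real.sqrt_eq_rpow, ← Real.rpow_natCast _ (Fintype.card ι),
              ← Real.rpow_mul (by positivity)]
            congr 1; ring
          rw [h1]
          gcongr
          have := mul_le_mul_of_nonneg_left (hw t) hs0.le
          linarith
  have hr2 : 2 ≤ (Fintype.card ι : ℝ) := by rw [hι]; push_cast; exact le_max_left _ _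
  have hrk : (k : ℝ) ≤ (Fintype.card ι : ℝ) := by rw [hι]; push_cast; exact le_max_right _ _
  have hI := integrable_one_add_sq_rpow
  set r : ℝ := (Fintype.card ι : ℝ) with hr
  calc _ ≤ ∫⁻ g, (∫⁻ t : ℝ, ENNReal.ofReal (Real.exp 2 / 2) *
      (ENNReal.ofReal (1 + √s * √(b g)) * ENNReal.ofReal (Real.exp (-s * q g t)))) ∂noiseLaw N :=
        lintegral_mono hpt
    _ = ∫⁻ t : ℝ, ∫⁻ g, ENNReal.ofReal (Real.exp 2 / 2) *
      (ENNReal.ofReal (1 + √s * √(b g)) * ENNReal.ofReal (Real.exp (-s * q g t))) ∂noiseLaw N := by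
        refine lintegral_lintegral_swap ?_
        refine Measurable.aemeasurable ?_
        unfold Function.uncurry
        fun_prop
    _ ≤ ∫⁻ t : ℝ, ENNReal.ofReal (Real.exp 2 / 2) *
        (ENNReal.ofReal (3 * s ^ (1 / 2 : ℝ) * 2 ^ (r / 8)) *
          (ENNReal.ofReal (s ^ (-(3 * r / 8))) *
            ENNReal.ofReal ((1 + t ^ 2) ^ (-(3 / 4) : ℝ)))) := by
        -- the exponent `4 / 3` keeps the power `(1 + t²) ^ (-3 r / 8)` integrable down to `r = 2`,
        -- which Cauchy-Schwarz would not
        gcongr with t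
        rw [lintegral_const_mul _ (by fun_prop)]
        gcongr
        have hH := ENNReal.lintegral_mul_le_Lp_mul_Lq (noiseLaw N)
          (p := 4) (q := 4 / 3) (by constructor <;> norm_num)
          (f := fun g => ENNReal.ofReal (1 + √s * √(b g)))
          (g := fun g => ENNReal.ofReal (Real.exp (-s * q g t)))
          (by fun_prop) (by fun_prop)
        refine hH.trans ?_
        gcongr
        · calc _ ≤ ENNReal.ofReal (72 * s ^ 2 * √2 ^ Fintype.card ι) ^ (1 / 4 : ℝ) := by
                gcongr
            _ ≤ _ := by
                rw [ENNReal.ofReal_rpow_of_nonneg (by positivity) (by norm_num)]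
                refine ENNReal.ofReal_le_ofReal ?_
                have h2 : (√2 ^ Fintype.card ι) ^ (1 / 4 : ℝ) = 2 ^ (r / 8) := by
                  rw [Real.sqrt_eq_rpow, ← Real.rpow_natCast, ← Real.rpow_mul (by positivity),
                    ← Real.rpow_mul (by positivity)]
                  congr 1; rw [hr]; ring
                have h3 : (s ^ 2) ^ (1 / 4 : ℝ) = s ^ (1 / 2 : ℝ) := by
                  rw [← Real.rpow_natCast, ← Real.rpow_mul hs0.le]; norm_num
                have h4 : (72 : ℝ) ^ (1 / 4 : ℝ) ≤ 3 := by
                  calc (72 : ℝ) ^ (1 / 4 : ℝ) ≤ (3 ^ (4 : ℕ)) ^ (1 / 4 : ℝ) :=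
                        Real.rpow_le_rpow (by norm_num) (by norm_num) (by norm_num)
                    _ = 3 := by
                        rw [← Real.rpow_natCast, ← Real.rpow_mul (by norm_num)]; norm_num
                rw [Real.mul_rpow (by positivity) (by positivity),
                  Real.mul_rpow (by positivity) (by positivity), h2, h3]
                gcongr
        · calc _ ≤ ENNReal.ofReal ((s * (1 + t ^ 2)) ^ (-(r / 2))) ^ (3 / 4 : ℝ) := by
                rw [show (1 / (4 / 3) : ℝ) = 3 / 4 by norm_num]
                gcongr
                exact hq43 t
            _ ≤ _ := by
                rw [ENNReal.ofReal_rpow_of_nonneg (by positivity) (by norm_num),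
                  ← ENNReal.ofReal_mul (by positivity)]
                refine ENNReal.ofReal_le_ofReal ?_
                rw [← Real.rpow_mul (by positivity), Real.mul_rpow hs0.le (by positivity)]
                rw [show -(r / 2) * (3 / 4) = -(3 * r / 8) by ring]
                refine mul_le_mul_of_nonneg_left ?_ (by positivity)
                refine Real.rpow_le_rpow_of_exponent_le ?_ (by linarith)
                nlinarith [sq_nonneg t]
    _ = ENNReal.ofReal (Real.exp 2 / 2 * (3 * s ^ (1 / 2 : ℝ) * 2 ^ (r / 8) * (s ^ (-(3 * r / 8)) *
          ∫ t : ℝ, (1 + t ^ 2) ^ (-(3 / 4) : ℝ)))) := by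
        rw [lintegral_const_mul _ (by fun_prop), lintegral_const_mul _ (by fun_prop),
          lintegral_const_mul _ (by fun_prop), ← ofReal_integral_eq_lintegral_ofReal hI
          (Filter.Eventually.of_forall fun t => by positivity),
          ← ENNReal.ofReal_mul (by positivity), ← ENNReal.ofReal_mul (by positivity),
          ← ENNReal.ofReal_mul (by positivity)]
    _ ≤ _ := by
        refine ENNReal.ofReal_le_ofReal ?_
        have h0 : 0 ≤ ∫ t : ℝ, (1 + t ^ 2) ^ (-(3 / 4) : ℝ) :=
          integral_nonneg fun t => by positivity
        have h1 : s ^ (1 / 2 : ℝ) * s ^ (-(3 * r / 8)) ≤ s ^ (-(k / 8 : ℝ)) := by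
          rw [← Real.rpow_add hs0]
          refine Real.rpow_le_rpow_of_exponent_le hs ?_
          linarith
        have h2 : (2 : ℝ) ^ (r / 8) ≤ 2 * 2 ^ (k / 8 : ℝ) := by
          have : r ≤ k + 8 := by
            rw [hr, hι]; push_cast
            refine max_le ?_ (by linarith)
            have : (0 : ℝ) ≤ k := by positivity
            linarith
          calc (2 : ℝ) ^ (r / 8) ≤ 2 ^ (1 + k / 8 : ℝ) := by
                refine Real.rpow_le_rpow_of_exponent_le (by norm_num) ?_
                linarith
            _ = _ := by rw [Real.rpow_add (by norm_num), Real.rpow_one]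
        have h3 : ((2 / s) ^ (1 / 8 : ℝ)) ^ k = 2 ^ (k / 8 : ℝ) * s ^ (-(k / 8 : ℝ)) := by
          rw [← Real.rpow_natCast, ← Real.rpow_mul (by positivity),
            Real.div_rpow (by norm_num) hs0.le, Real.rpow_neg hs0.le, div_eq_mul_inv]
          congr 2 <;> ring_nf
        rw [h3, columnConst]
        calc _ = (Real.exp 2 / 2 * 3 * ∫ t : ℝ, (1 + t ^ 2) ^ (-(3 / 4) : ℝ)) *
              (2 ^ (r / 8) * (s ^ (1 / 2 : ℝ) * s ^ (-(3 * r / 8)))) := by ring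
          _ ≤ (Real.exp 2 / 2 * 3 * ∫ t : ℝ, (1 + t ^ 2) ^ (-(3 / 4) : ℝ)) *
              ((2 * 2 ^ (k / 8 : ℝ)) * s ^ (-(k / 8 : ℝ))) := by gcongr
          _ = _ := by ring

/-! ### Conditioning on a column, and Gram-Schmidt vectors -/

lemma measurePreserving_update {ι α : Type*} [Fintype ι] [DecidableEq ι] [MeasurableSpace α]
    (μ : Measure α) [IsProbabilityMeasure μ] (t : ι) :
    MeasurePreserving (fun p : (ι → α) × α => Function.update p.1 t p.2)
      ((Measure.pi fun _ => μ).prod μ) (Measure.pi fun _ => μ) := by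
  have hm : Measurable (fun p : (ι → α) × α => Function.update p.1 t p.2) := by
    refine measurable_pi_lambda _ fun i => ?_
    by_cases h : i = t
    · subst h; simpa using measurable_snd
    · simp only [Function.update_of_ne h]; fun_prop
  refine ⟨hm, (Measure.pi_eq fun s hs => ?_).symm⟩
  rw [Measure.map_apply hm (MeasurableSet.univ_pi hs)]
  have : (fun p : (ι → α) × α => Function.update p.1 t p.2) ⁻¹' Set.univ.pi s =
      (Set.univ.pi (Function.update s t Set.univ)) ×ˢ s t := by
    ext p
    simp only [Set.mem_preimage, Set.mem_pi, Set.mem_univ, true_imp_iff, Set.mem_prod]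
    constructor
    · intro h
      refine ⟨fun i => ?_, by simpa using h t⟩
      by_cases hi : i = t
      · subst hi; simp
      · simpa [Function.update_of_ne hi] using h i
    · rintro ⟨h1, h2⟩ i
      by_cases hi : i = t
      · subst hi; simpa using h2
      · simpa [Function.update_of_ne hi] using h1 i
  rw [this, Measure.prod_prod, Measure.pi_pi, ← Finset.prod_erase_mul _ _ (Finset.mem_univ t),
    ← Finset.prod_erase_mul _ _ (Finset.mem_univ t)]
  simp only [Function.update_self, measure_univ, mul_one]
  congr 1
  exact Finset.prod_congr rfl fun i hi => by rw [Function.update_of_ne (Finset.ne_of_mem_erase hi)]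

/-- To bound an integral over the channel it suffices to average over one of its columns. No
measurability is needed, as only an upper bound is claimed. -/
lemma lintegral_channelLaw_le {N M : ℕ} (t : Fin M) (F : (Fin N → Fin M → ℂ) → ℝ≥0∞) (K : ℝ≥0∞)
    (h : ∀ H : Fin N → Fin M → ℂ,
      ∫⁻ g, F (fun i => Function.update (H i) t (g i)) ∂noiseLaw N ≤ K) :
    ∫⁻ H, F H ∂channelLaw N M ≤ K := by
  have h1 : MeasurePreserving (fun (p : Fin N → (Fin M → ℂ) × ℂ) i =>
      Function.update (p i).1 t (p i).2)
      (Measure.pi fun _ => (Measure.pi fun _ => stdComplexGaussian).prod stdComplexGaussian)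
      (channelLaw N M) :=
    measurePreserving_pi _ _ fun _ => measurePreserving_update stdComplexGaussian t
  have h2 := (measurePreserving_arrowProdEquivProdArrow (Fin M → ℂ) ℂ (Fin N)
    (fun _ => Measure.pi fun _ => stdComplexGaussian) (fun _ => stdComplexGaussian)).symm
  have h3 := h1.comp h2
  rw [← h3.map_eq]
  refine (lintegral_map_le _ _).trans ?_
  refine (lintegral_prod_le _).trans ?_
  calc _ ≤ ∫⁻ _, K ∂(channelLaw N M) := lintegral_mono fun H => h H
    _ = K := by simp

section GramSchmidt

open InnerProductSpace

variable {E : Type*} [NormedAddCommGroup E] [InnerProductSpace ℝ E]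

lemma inner_gramSchmidtNormed_of_ne {m : ℕ} (f : Fin m → E) {i j : Fin m} (h : i ≠ j) :
    inner ℝ (gramSchmidtNormed ℝ f i) (gramSchmidtNormed ℝ f j) = 0 := by
  simp [gramSchmidtNormed, inner_smul_left, inner_smul_right, gramSchmidt_orthogonal ℝ f h]

lemma inner_gramSchmidtNormed_of_lt {m : ℕ} (f : Fin m → E) {i j : Fin m} (h : j < i) :
    inner ℝ (gramSchmidtNormed ℝ f i) (f j) = 0 := by
  simp [gramSchmidtNormed, inner_smul_left, gramSchmidt_inv_triangular ℝ f h]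

lemma norm_gramSchmidtNormed_sq_smul {m : ℕ} (f : Fin m → E) (i : Fin m) :
    ‖gramSchmidtNormed ℝ f i‖ ^ 2 • gramSchmidtNormed ℝ f i = gramSchmidtNormed ℝ f i := by
  by_cases h : gramSchmidtNormed ℝ f i = 0
  · rw [h]; simp
  · rw [gramSchmidtNormed_unit_length' h]; simp

/-- The Gram-Schmidt vectors reproduce every vector of the span, also when the family is linearly
dependent and some of them vanish. -/
lemma sum_inner_gramSchmidtNormed_smul {m : ℕ} (f : Fin m → E) {x : E}
    (hx : x ∈ Submodule.span ℝ (Set.range f)) :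
    ∑ i, inner ℝ (gramSchmidtNormed ℝ f i) x • gramSchmidtNormed ℝ f i = x := by
  rw [← span_gramSchmidt ℝ f, ← span_gramSchmidtNormed_range] at hx
  induction hx using Submodule.span_induction with
  | mem x hx =>
    obtain ⟨j, rfl⟩ := hx
    rw [Finset.sum_eq_single j, real_inner_self_eq_norm_sq, norm_gramSchmidtNormed_sq_smul]
    · intro i _ hij
      rw [inner_gramSchmidtNormed_of_ne f hij, zero_smul]
    · simp
  | zero => simp
  | add x y _ _ hx hy => simp only [inner_add_right, add_smul, Finset.sum_add_distrib, hx, hy]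
  | smul a x _ hx =>
    simp only [inner_smul_right, mul_smul, ← Finset.smul_sum, hx]

lemma exists_norm_sq_le_sum_inner_sq {m : ℕ} (f : Fin m → E) {x : E}
    (hx : x ∈ Submodule.span ℝ (Set.range f)) (c : Fin m) :
    ∃ y ∈ Submodule.span ℝ (f '' Set.Iio c),
      ‖x - y‖ ^ 2 ≤ ∑ i ∈ Finset.Ici c, inner ℝ (gramSchmidtNormed ℝ f i) x ^ 2 := by
  set q := gramSchmidtNormed ℝ f with hq
  refine ⟨∑ i ∈ Finset.Iio c, inner ℝ (q i) x • q i, ?_, ?_⟩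
  · rw [← span_gramSchmidt_Iio ℝ f c, ← span_gramSchmidtNormed]
    exact Submodule.sum_mem _ fun i hi => Submodule.smul_mem _ _
      (Submodule.subset_span ⟨i, Finset.mem_Iio.1 hi, rfl⟩)
  · have h1 : x - ∑ i ∈ Finset.Iio c, inner ℝ (q i) x • q i =
        ∑ i ∈ Finset.Ici c, inner ℝ (q i) x • q i := by
      have : (Finset.Iio c)ᶜ = Finset.Ici c := by ext; simp
      rw [sub_eq_iff_eq_add', ← this, Finset.sum_add_sum_compl]
      exact (sum_inner_gramSchmidtNormed_smul f hx).symm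
    rw [h1, ← real_inner_self_eq_norm_sq, sum_inner]
    refine Finset.sum_le_sum fun i hi => ?_
    rw [inner_smul_left, inner_sum, Finset.sum_eq_single i]
    · rw [inner_smul_right, real_inner_self_eq_norm_sq]
      have hn : ‖q i‖ ^ 2 ≤ 1 := by
        by_cases h : q i = 0
        · simp [h]
        · rw [hq, gramSchmidtNormed_unit_length' h]; simp
      simp only [conj_trivial]
      nlinarith [sq_nonneg (inner ℝ (q i) x)]
    · intro j _ hj
      rw [inner_smul_right, hq, inner_gramSchmidtNormed_of_ne f hj.symm, mul_zero]
    · exact fun h => absurd hi h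

/-- An orthonormal family of a prescribed size orthogonal to few given vectors. -/
lemma exists_orthonormal_orthogonal {n r : ℕ} {ι : Type*} (s : Finset ι)
    (f : ι → EuclideanSpace ℝ (Fin n)) (h : s.card + r ≤ n) :
    ∃ e : Fin r → EuclideanSpace ℝ (Fin n), Orthonormal ℝ e ∧
      ∀ i, ∀ j ∈ s, inner ℝ (e i) (f j) = 0 := by
  classical
  set V := Submodule.span ℝ ((s.image f : Finset _) : Set (EuclideanSpace ℝ (Fin n))) with hV
  have h1 : Module.finrank ℝ V ≤ s.card :=
    (finrank_span_finset_le_card _).trans Finset.card_image_le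
  have h2 := V.finrank_add_finrank_orthogonal
  rw [finrank_euclideanSpace_fin] at h2
  have h3 : r ≤ Module.finrank ℝ Vᗮ := by omega
  let b := stdOrthonormalBasis ℝ Vᗮ
  refine ⟨fun i => (b (Fin.castLE h3 i) : EuclideanSpace ℝ (Fin n)), ?_, fun i j hj => ?_⟩
  · exact (b.orthonormal.comp_linearIsometry Vᗮ.subtypeₗᵢ).comp _ (Fin.castLE_injective h3)
  · exact V.inner_left_of_mem_orthogonal
      (Submodule.subset_span (by simpa using ⟨j, hj, rfl⟩)) (b (Fin.castLE h3 i)).2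

end GramSchmidt

/-! ### The channel average -/

/-- The columns of the real form of a complex matrix. -/
noncomputable def realColumn {N M : ℕ} (H : Fin N → Fin M → ℂ) (j : Fin (M + M)) :
    EuclideanSpace ℝ (Fin (N + N)) :=
  WithLp.toLp 2 fun l => realMat H l j

lemma realColumn_castAdd {N M : ℕ} (H : Fin N → Fin M → ℂ) (t : Fin M) :
    realColumn H (Fin.castAdd M t) = WithLp.toLp 2 (realVec fun n => 1 * H n t) := by
  ext l
  refine Fin.addCases (fun i => ?_) (fun i => ?_) l
  · simp [realColumn, realMat, realVec, Fin.append_left]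
  · simp only [realColumn, realMat, realVec, Fin.append_right, Matrix.reindex_apply,
      Matrix.submatrix_apply, finSumFinEquiv_symm_apply_natAdd, finSumFinEquiv_symm_apply_castAdd]
    simp

lemma realColumn_natAdd {N M : ℕ} (H : Fin N → Fin M → ℂ) (t : Fin M) :
    realColumn H (Fin.natAdd M t) = WithLp.toLp 2 (realVec fun n => Complex.I * H n t) := by
  ext l
  refine Fin.addCases (fun i => ?_) (fun i => ?_) l
  · simp only [realColumn, realMat, realVec, Fin.append_left, Matrix.reindex_apply,
      Matrix.submatrix_apply, finSumFinEquiv_symm_apply_natAdd, finSumFinEquiv_symm_apply_castAdd]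
    simp
  · simp only [realColumn, realMat, realVec, Fin.append_right, Matrix.reindex_apply,
      Matrix.submatrix_apply, finSumFinEquiv_symm_apply_natAdd]
    simp

lemma realColumn_update_of_ne {N M : ℕ} (H : Fin N → Fin M → ℂ) (t : Fin M) (g : Fin N → ℂ)
    {j : Fin (M + M)} (h1 : j ≠ Fin.castAdd M t) (h2 : j ≠ Fin.natAdd M t) :
    realColumn (fun i => Function.update (H i) t (g i)) j = realColumn H j := by
  revert h1 h2
  refine Fin.addCases (fun i => ?_) (fun i => ?_) j
  · intro h1 _
    have : i ≠ t := fun h => h1 (by rw [h])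
    simp only [realColumn_castAdd, Function.update_of_ne this]
  · intro _ h2
    have : i ≠ t := fun h => h2 (by rw [h])
    simp only [realColumn_natAdd, Function.update_of_ne this]

/-- The common form of the two cases of `lintegral_exp_neg_sum_inner_sq_channelLaw_le`: the columns
`j₀` and `p` are the two real columns coming from the complex column `t`. -/
lemma lintegral_exp_neg_sum_inner_sq_channelLaw_le_aux {N M : ℕ} (hMN : M ≤ N) (t : Fin M)
    {j₀ p : Fin (M + M)} (hp : j₀ ≠ p) {v u : ℂ} (hu : ‖u‖ = 1)
    (hvu : ∀ a b : ℝ, ‖a * v + b * u‖ ^ 2 = a ^ 2 + b ^ 2)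
    (hj : ∀ H : Fin N → Fin M → ℂ,
      realColumn H j₀ = WithLp.toLp 2 (realVec fun n => v * H n t))
    (hpc : ∀ H : Fin N → Fin M → ℂ,
      realColumn H p = WithLp.toLp 2 (realVec fun n => u * H n t))
    (hne : ∀ (H : Fin N → Fin M → ℂ) (g : Fin N → ℂ), ∀ j, j ≠ j₀ → j ≠ p →
      realColumn (fun i => Function.update (H i) t (g i)) j = realColumn H j)
    {c : Fin (M + M)} (hc : c ≤ j₀) (d : Fin (M + M) → ℝ) (hd : 1 ≤ |d j₀|) {s β : ℝ} (hs : 1 ≤ s)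
    (hβ : 32 * s ≤ β ^ 2) {k : ℕ} (hk : c + k ≤ M + M) :
    ∫⁻ H, ENNReal.ofReal (Real.exp (-(1 / 16) * ∑ i ∈ Finset.Ici c,
      inner ℝ (InnerProductSpace.gramSchmidtNormed ℝ (fun j => β • realColumn H j) i)
        (∑ j, d j • β • realColumn H j) ^ 2)) ∂channelLaw N M ≤
      ENNReal.ofReal (columnConst * ((2 / s) ^ (1 / 8 : ℝ)) ^ k) := by
  classical
  refine lintegral_channelLaw_le t _ _ fun H => ?_
  set R := (Finset.Iio c).erase p with hR
  have hcard : R.card + max 2 k ≤ N + N := by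
    have hc1 : (Finset.Iio c).card = c := Fin.card_Iio c
    by_cases hpc : p < c
    · have : R.card = c - 1 := by
        rw [hR, Finset.card_erase_of_mem (Finset.mem_Iio.2 hpc), hc1]
      have h3 : (p : ℕ) < c := hpc
      have h4 := c.2
      rw [this]
      rcases max_cases 2 k with ⟨h, _⟩ | ⟨h, _⟩ <;> rw [h] <;> omega
    · have : R.card ≤ c := (Finset.card_erase_le).trans hc1.le
      -- the distinct indices `j₀` and `p` both lie in `[c, 2M)`
      have h3 : (c : ℕ) ≤ p := not_lt.1 hpc
      have h4 : (c : ℕ) ≤ j₀ := hc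
      have h5 : (j₀ : ℕ) ≠ p := fun h => hp (Fin.ext h)
      have h6 := j₀.2
      have h7 := p.2
      rcases max_cases 2 k with ⟨h, _⟩ | ⟨h, _⟩ <;> rw [h] <;> omega
  obtain ⟨e, he, heo⟩ := exists_orthonormal_orthogonal R (realColumn H) hcard
  set cst : Fin (max 2 k) → ℝ := fun i =>
    ∑ j ∈ (Finset.univ.erase j₀).erase p, d j * inner ℝ (e i) (realColumn H j) with hcst
  refine lintegral_column_le he (u := u) (w := d j₀ * v) hu (fun b => ?_) hs cst k (by simp) _
    fun g => ?_
  · rw [hvu]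
    have : 1 ≤ d j₀ ^ 2 := by rw [← sq_abs]; nlinarith
    linarith
  set H' : Fin N → Fin M → ℂ := fun i => Function.update (H i) t (g i) with hH'
  have hHt : ∀ n, H' n t = g n := fun n => by simp [hH']
  have hβ0 : β ≠ 0 := by rintro rfl; norm_num at hβ; linarith
  set x := ∑ j, d j • β • realColumn H' j with hx
  obtain ⟨y, hy, hxy⟩ := exists_norm_sq_le_sum_inner_sq (fun j => β • realColumn H' j) (x := x)
    (Submodule.sum_mem _ fun j _ => Submodule.smul_mem _ _ (Submodule.subset_span ⟨j, rfl⟩)) c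
  have hy' : y ∈ Submodule.span ℝ (insert (realColumn H' p) (realColumn H' '' R)) := by
    refine (Submodule.span_le.2 ?_) hy
    rintro _ ⟨j, hj, rfl⟩
    refine Submodule.smul_mem _ _ (Submodule.subset_span ?_)
    by_cases hjp : j = p
    · left; rw [hjp]
    · right; exact ⟨j, by simp [hR, hjp, Set.mem_Iio.1 hj], rfl⟩
  obtain ⟨a, z, hz, rfl⟩ := Submodule.mem_span_insert.1 hy'
  have hRne : ∀ j ∈ R, realColumn H' j = realColumn H j := by
    intro j hj
    rw [hR, Finset.mem_erase, Finset.mem_Iio] at hj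
    exact hne H g j (fun h => absurd (h ▸ hj.2) (not_lt.2 hc)) hj.1
  have hez : ∀ i, inner ℝ (e i) z = 0 := by
    intro i
    have : z ∈ (ℝ ∙ e i)ᗮ := by
      refine (Submodule.span_le.2 ?_) hz
      rintro _ ⟨j, hj, rfl⟩
      rw [SetLike.mem_coe, Submodule.mem_orthogonal_singleton_iff_inner_right, hRne j hj]
      exact heo i j hj
    exact Submodule.mem_orthogonal_singleton_iff_inner_right.1 this
  refine ⟨d p - a / β, ENNReal.ofReal_le_ofReal (Real.exp_le_exp.2 ?_)⟩
  have hkey : ∀ i, inner ℝ (e i) (x - (a • realColumn H' p + z)) =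
      β * (inner ℝ (e i) (WithLp.toLp 2 (realVec (fun n =>
        (d j₀ * v + (d p - a / β : ℝ) * u) * g n))) + cst i) := by
    intro i
    have h1 : inner ℝ (e i) x = β * (d j₀ * inner ℝ (e i) (realColumn H' j₀) +
        d p * inner ℝ (e i) (realColumn H' p) + cst i) := by
      rw [hx, inner_sum, ← Finset.add_sum_erase _ _ (Finset.mem_univ j₀),
        ← Finset.add_sum_erase _ _ (Finset.mem_erase.2 ⟨hp.symm, Finset.mem_univ p⟩), hcst]
      simp only [inner_smul_right]
      rw [mul_add, Finset.mul_sum, ← add_assoc]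
      congr 1
      · ring
      · refine Finset.sum_congr rfl fun j hj => ?_
        rw [Finset.mem_erase, Finset.mem_erase] at hj
        rw [hne H g j hj.2.1 hj.1]
        ring
    rw [inner_sub_right, h1, inner_add_right, hez, inner_smul_right, add_zero]
    have h2 : inner ℝ (e i) (WithLp.toLp 2 (realVec (fun n =>
        (d j₀ * v + (d p - a / β : ℝ) * u) * g n))) =
        d j₀ * inner ℝ (e i) (realColumn H' j₀) +
          (d p - a / β) * inner ℝ (e i) (realColumn H' p) := by
      rw [hj, hpc]
      simp only [hHt, inner_realVec, Finset.mul_sum]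
      rw [← Finset.sum_add_distrib]
      refine Finset.sum_congr rfl fun n _ => ?_
      simp
      ring
    rw [h2]
    field_simp
    ring
  have hbessel := he.sum_inner_products_le (x - (a • realColumn H' p + z)) (s := Finset.univ)
  simp only [hkey, Real.norm_eq_abs, sq_abs, mul_pow, ← Finset.mul_sum] at hbessel
  have hnn : 0 ≤ ∑ i, (inner ℝ (e i) (WithLp.toLp 2 (realVec (fun n =>
        (d j₀ * v + (d p - a / β : ℝ) * u) * g n))) + cst i) ^ 2 :=
    Finset.sum_nonneg fun i _ => sq_nonneg _
  have hfin := mul_le_mul_of_nonneg_right hβ hnn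
  linarith [hbessel.trans hxy]

/-- The part of `B d` seen by the rows `i ≥ c` of the triangular factor is large with overwhelming
probability as soon as `d` has an entry of size at least one among those rows. Here `B` is `β` times
the real form of the channel. The bound decays exponentially in the number of rows. -/
lemma lintegral_exp_neg_sum_inner_sq_channelLaw_le {N M : ℕ} (hMN : M ≤ N)
    {c j₀ : Fin (M + M)} (hc : c ≤ j₀) (d : Fin (M + M) → ℝ) (hd : 1 ≤ |d j₀|) {s β : ℝ}
    (hs : 1 ≤ s) (hβ : 32 * s ≤ β ^ 2) {k : ℕ} (hk : c + k ≤ M + M) :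
    ∫⁻ H, ENNReal.ofReal (Real.exp (-(1 / 16) * ∑ i ∈ Finset.Ici c,
      inner ℝ (InnerProductSpace.gramSchmidtNormed ℝ (fun j => β • realColumn H j) i)
        (∑ j, d j • β • realColumn H j) ^ 2)) ∂channelLaw N M ≤
      ENNReal.ofReal (columnConst * ((2 / s) ^ (1 / 8 : ℝ)) ^ k) := by
  revert hc hd
  refine Fin.addCases (fun t => ?_) (fun t => ?_) j₀ <;> intro hc hd
  · refine lintegral_exp_neg_sum_inner_sq_channelLaw_le_aux hMN t (p := Fin.natAdd M t) (v := 1)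
      (u := Complex.I) ?_ (by simp) (fun a b => ?_) (fun H => realColumn_castAdd H t)
      (fun H => realColumn_natAdd H t) (fun H g j h1 h2 => realColumn_update_of_ne H t g h1 h2)
      hc d hd hs hβ hk
    · intro h
      have := congrArg Fin.val h
      simp at this
      omega
    · rw [← Complex.normSq_eq_norm_sq, Complex.normSq_apply]; simp; ring
  · refine lintegral_exp_neg_sum_inner_sq_channelLaw_le_aux hMN t (p := Fin.castAdd M t)
      (v := Complex.I) (u := 1) ?_ (by simp) (fun a b => ?_) (fun H => realColumn_natAdd H t)
      (fun H => realColumn_castAdd H t) (fun H g j h1 h2 => realColumn_update_of_ne H t g h2 h1)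
      hc d hd hs hβ hk
    · intro h
      have := congrArg Fin.val h
      simp at this
      omega
    · rw [← Complex.normSq_eq_norm_sq, Complex.normSq_apply]; simp; ring

/-! ### The stack algorithm -/

/-- What the stack algorithm maintains. The last field is the one of interest: every generated node
that leaves the path to the leaf `x` after level `l` was, when generated, at most as costly as some
deeper node of that path. -/
structure StackInvariant {Q : ℕ} (m : ℕ) (h : TreeNode Q → ℝ) (x : TreeNode Q)
    (s : StackState Q) : Prop where
  mem_generated : ∀ p ∈ s.active, p ∈ s.generated
  length_le : ∀ p ∈ s.generated, p.length ≤ m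
  parent : ∀ p a, p ++ [a] ∈ s.generated → p ∈ s.generated
  sorted : s.active.Pairwise fun u v => stackCost m h s.generated u ≤ stackCost m h s.generated v
  saturated : s.active ≠ [] → ∀ q ∈ s.generated,
    q ∈ s.active ∨ q.length < m ∧ ∀ a, q ++ [a] ∈ s.generated
  cost_le : ∀ p ∈ s.generated, ∀ l a w, l < m → p = x.take l ++ a :: w → x[l]? ≠ some a →
    ∃ j, l < j ∧ j ≤ m ∧ h p ≤ h (x.take j)

lemma stackInvariant_init {Q : ℕ} (m : ℕ) (h : TreeNode Q → ℝ) (x : TreeNode Q) :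
    StackInvariant m h x (stackInit Q) where
  mem_generated := by simp [stackInit]
  length_le := by simp [stackInit]
  parent := by simp [stackInit]
  sorted := by simp [stackInit]
  saturated := by simp [stackInit]
  cost_le := by simp [stackInit]

lemma StackInvariant.prefix_mem {Q m : ℕ} {h : TreeNode Q → ℝ} {x : TreeNode Q} {s : StackState Q}
    (hs : StackInvariant m h x s) (u w : TreeNode Q) (hw : u ++ w ∈ s.generated) :
    u ∈ s.generated := by
  induction w using List.reverseRecOn with
  | nil => simpa using hw
  | append_singleton w a ih => exact ih (hs.parent _ a (by simpa using hw))

/-- As long as the search runs, ACTIVE holds an entry whose cost is at most that of a node of the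
path to the leaf `x` below any generated node of that path. -/
lemma StackInvariant.exists_stackCost_le {Q m : ℕ} {h : TreeNode Q → ℝ} {x : TreeNode Q}
    {s : StackState Q} (hs : StackInvariant m h x s) (hx : x.length = m) (hne : s.active ≠ [])
    {l : ℕ} (hl : l < m) (hmem : x.take l ∈ s.generated) :
    ∃ q ∈ s.active, ∃ j, l < j ∧ j ≤ m ∧ stackCost m h s.generated q ≤ (h (x.take j) : EReal) := by
  classical
  set j := Nat.findGreatest (fun j => x.take j ∈ s.generated) m with hj
  have hjm : j ≤ m := Nat.findGreatest_le m
  have hlj : l ≤ j := Nat.le_findGreatest hl.le hmem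
  have hjmem : x.take j ∈ s.generated :=
    Nat.findGreatest_spec (P := fun j => x.take j ∈ s.generated) hl.le hmem
  have hlen : (x.take j).length = j := by rw [List.length_take, hx]; omega
  rcases hjm.eq_or_lt with hjm' | hjm'
  · rcases hs.saturated hne _ hjmem with h1 | ⟨h1, _⟩
    · exact ⟨_, h1, m, hl, le_rfl, by rw [stackCost, if_pos (hlen.trans hjm')]; exact bot_le⟩
    · omega
  · have hnot : x.take (j + 1) ∉ s.generated :=
      Nat.findGreatest_is_greatest (P := fun j => x.take j ∈ s.generated) (Nat.lt_succ_self j) hjm'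
    have hjx : j < x.length := by omega
    have htake : x.take (j + 1) = x.take j ++ [x[j]] :=
      (List.take_append_getElem hjx).symm
    rcases hs.saturated hne _ hjmem with h1 | ⟨_, h1⟩
    · refine ⟨_, h1, j + 1, by omega, hjm', ?_⟩
      rw [stackCost, if_neg (by omega), htake]
      exact iInf₂_le x[j] (by simp [remaining, ← htake, hnot])
    · exact absurd (htake ▸ h1 x[j]) hnot

lemma StackInvariant.step {Q m : ℕ} {h : TreeNode Q → ℝ} {x : TreeNode Q} {s : StackState Q}
    (hs : StackInvariant m h x s) (hx : x.length = m) : StackInvariant m h x (stackStep m h s) := by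
  unfold stackStep
  split
  · exact hs
  · rename_i p rest hact
    have hpmem : p ∈ s.generated := hs.mem_generated p (by simp [hact])
    have hsorted := hs.sorted
    rw [hact, List.pairwise_cons] at hsorted
    split
    · exact ⟨by simp, hs.length_le, hs.parent, by simp, by simp, hs.cost_le⟩
    · rename_i hlen
      have hplt : p.length < m := lt_of_le_of_ne (hs.length_le p hpmem) hlen
      split
      · rename_i harg
        have hrem : remaining s.generated p = [] := List.argmin_eq_none.1 harg
        refine ⟨fun q hq => hs.mem_generated q (by simp [hact, hq]), hs.length_le, hs.parent,
          hsorted.2, fun _ q hq => ?_, hs.cost_le⟩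
        rcases hs.saturated (by simp [hact]) q hq with h1 | h1
        · rw [hact, List.mem_cons] at h1
          rcases h1 with rfl | h1
          · refine Or.inr ⟨hplt, fun a => ?_⟩
            simpa [remaining] using List.filter_eq_nil_iff.1 hrem a (List.mem_finRange a)
          · exact Or.inl h1
        · exact Or.inr h1
      · rename_i a harg
        have hcost : ((h (p ++ [a]) : ℝ) : EReal) ≤ stackCost m h s.generated p := by
          rw [stackCost, if_neg hlen]
          refine le_iInf₂ fun a' ha' => ?_
          exact_mod_cast List.le_of_mem_argmin ha' harg
        refine ⟨fun q hq => ?_, fun q hq => ?_, fun q b hq => ?_, ?_, fun _ q hq => ?_,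
          fun q hq l b w hl hqe hb => ?_⟩
        · rw [List.mem_insertionSort] at hq
          simp only [List.mem_cons] at hq
          simp only [Finset.mem_insert]
          rcases hq with rfl | rfl | hq
          · exact Or.inl rfl
          · exact Or.inr hpmem
          · exact Or.inr (hs.mem_generated q (by simp [hact, hq]))
        · rcases Finset.mem_insert.1 hq with rfl | hq
          · simpa using hplt
          · exact hs.length_le q hq
        · refine Finset.mem_insert_of_mem ?_
          rcases Finset.mem_insert.1 hq with hq | hq
          · rw [(List.append_inj' hq rfl).1]; exact hpmem
          · exact hs.parent q b hq
        · have : Std.Total fun u v => stackCost m h (insert (p ++ [a]) s.generated) u ≤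
              stackCost m h (insert (p ++ [a]) s.generated) v := ⟨fun _ _ => le_total _ _⟩
          have : IsTrans _ fun u v => stackCost m h (insert (p ++ [a]) s.generated) u ≤
              stackCost m h (insert (p ++ [a]) s.generated) v := ⟨fun _ _ _ => le_trans⟩
          exact List.pairwise_insertionSort _ _
        · rw [List.mem_insertionSort]
          rcases Finset.mem_insert.1 hq with rfl | hq
          · exact Or.inl (by simp)
          · rcases hs.saturated (by simp [hact]) q hq with h1 | h1
            · exact Or.inl (List.mem_cons_of_mem _ (hact ▸ h1))
            · exact Or.inr ⟨h1.1, fun b => Finset.mem_insert_of_mem (h1.2 b)⟩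
        · rcases Finset.mem_insert.1 hq with rfl | hq
          · have hp : p = x.take l ++ (b :: w).dropLast := by
              have := congrArg List.dropLast hqe
              rwa [List.dropLast_concat, List.dropLast_append_of_ne_nil (by simp)] at this
            obtain ⟨q, hq, j, hlj, hjm, hqj⟩ := hs.exists_stackCost_le hx (by simp [hact]) hl
              (hs.prefix_mem _ _ (hp ▸ hpmem))
            refine ⟨j, hlj, hjm, ?_⟩
            have h1 : stackCost m h s.generated p ≤ stackCost m h s.generated q := by
              rw [hact, List.mem_cons] at hq
              rcases hq with rfl | hq
              · exact le_rfl
              · exact hsorted.1 q hq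
            exact_mod_cast hcost.trans (h1.trans hqj)
          · exact hs.cost_le q hq l b w hl hqe hb

lemma stackInvariant_iterate {Q m : ℕ} (h : TreeNode Q → ℝ) {x : TreeNode Q} (hx : x.length = m)
    (t : ℕ) : StackInvariant m h x ((stackStep m h)^[t] (stackInit Q)) := by
  induction t with
  | zero => exact stackInvariant_init m h x
  | succ t ih => rw [Function.iterate_succ_apply']; exact ih.step hx

lemma length_le_of_mem_generatedNodes {Q m : ℕ} {h : TreeNode Q → ℝ} {x : TreeNode Q}
    (hx : x.length = m) {p : TreeNode Q} (hp : p ∈ generatedNodes m h) : p.length ≤ m := by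
  obtain ⟨t, ht⟩ := hp
  have hs := stackInvariant_iterate h hx t
  exact hs.length_le p (hs.mem_generated p ht)

/-- A node off the path to the leaf `x` is generated only if it costs at most as much as some node
of that path below the branching point. -/
lemma exists_cost_le_of_mem_generatedNodes {Q m : ℕ} {h : TreeNode Q → ℝ} {x : TreeNode Q}
    (hx : x.length = m) {l : ℕ} (hl : l < m) {a : Fin Q} {w : TreeNode Q}
    (ha : x[l]? ≠ some a) (hp : x.take l ++ a :: w ∈ generatedNodes m h) :
    ∃ j, l < j ∧ j ≤ m ∧ h (x.take l ++ a :: w) ≤ h (x.take j) := by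
  obtain ⟨t, ht⟩ := hp
  have hs := stackInvariant_iterate h hx t
  exact hs.cost_le _ (hs.mem_generated _ ht) l a w hl rfl ha

/-! ### Node costs in terms of the error vector -/

section Cost

variable {n m Q : ℕ} (B : Matrix (Fin n) (Fin m) ℝ)

/-- The columns of a matrix as vectors of Euclidean space. -/
noncomputable def euclideanColumn (j : Fin m) : EuclideanSpace ℝ (Fin n) :=
  WithLp.toLp 2 fun l => B l j

/-- The labels of a tree node in the original order of the coordinates, padded with zeros. -/
noncomputable def paddedLabels (m : ℕ) (p : TreeNode Q) (j : Fin m) : ℝ :=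
  (List.map (fun a : Fin Q => ((a : ℕ) : ℝ)) p).getD j.rev 0

/-- The left-hand side, as it occurs in `edgeWeight`, elaborates with a monadic lift of the coercion
`Fin Q → ℕ`, which is here resolved into a plain map. -/
lemma map_labels_eq (p : TreeNode Q) :
    (p.map fun a => ((a : ℕ) : ℝ)) = List.map (fun a : Fin Q => ((a : ℕ) : ℝ)) p := by
  simp [List.bind_eq_flatMap, List.map_eq_flatMap, List.flatMap_assoc]

/-- The leaf of the tree that corresponds to an information vector. -/
def leafOf (x : Fin m → Fin Q) : TreeNode Q := List.ofFn fun k => x k.rev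

lemma qrColumn_eq (i : Fin m) :
    qrColumn B i = InnerProductSpace.gramSchmidtNormed ℝ (euclideanColumn B) i := rfl

lemma inner_qrColumn_of_lt {i j : Fin m} (h : j < i) :
    inner ℝ (qrColumn B i) (euclideanColumn B j) = 0 :=
  inner_gramSchmidtNormed_of_lt _ h

lemma edgeWeight_eq (x : Fin m → ℝ) (ζ : EuclideanSpace ℝ (Fin n)) (p : TreeNode Q) (i : Fin m)
    {u : Fin n → ℝ} (hu : WithLp.toLp 2 u = ∑ j, x j • euclideanColumn B j + ζ) :
    edgeWeight (treeMatrix B) (treeVector B u) p i =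
      (inner ℝ (qrColumn B i.rev) ζ +
        inner ℝ (qrColumn B i.rev)
          (∑ j, (x j - paddedLabels m p j) • euclideanColumn B j)) ^ 2 := by
  have h1 : ∑ j ∈ Finset.Iic i,
      treeMatrix B i j * (List.map (fun a : Fin Q => ((a : ℕ) : ℝ)) p).getD j 0 =
      ∑ j, paddedLabels m p j * inner ℝ (qrColumn B i.rev) (euclideanColumn B j) := by
    rw [← Equiv.sum_comp Fin.revPerm]
    refine (Finset.sum_subset (Finset.subset_univ _) fun j _ hj => ?_).trans
      (Finset.sum_congr rfl fun j _ => ?_)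
    · rw [Finset.mem_Iic, not_le] at hj
      have : inner ℝ (qrColumn B i.rev) (euclideanColumn B j.rev) = 0 :=
        inner_qrColumn_of_lt B (Fin.rev_lt_rev.2 hj)
      simp only [treeMatrix, Matrix.of_apply]
      rw [show inner ℝ (qrColumn B i.rev) (WithLp.toLp 2 fun l => B l j.rev) = 0 from this,
        zero_mul]
    · simp only [paddedLabels, treeMatrix, Matrix.of_apply, Fin.revPerm_apply, Fin.rev_rev]
      rw [mul_comm]; rfl
  rw [edgeWeight, map_labels_eq, h1, treeVector, hu, inner_add_right, inner_sum, inner_sum]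
  congr 1
  simp only [inner_smul_right, sub_mul, Finset.sum_sub_distrib]
  ring

lemma inner_qrColumn_sum_eq_zero (d : Fin m → ℝ) (i : Fin m) (hd : ∀ j, j.rev ≤ i → d j = 0) :
    inner ℝ (qrColumn B i.rev) (∑ j, d j • euclideanColumn B j) = 0 := by
  rw [inner_sum]
  refine Finset.sum_eq_zero fun j _ => ?_
  rw [inner_smul_right]
  by_cases h : j.rev ≤ i
  · rw [hd j h, zero_mul]
  · rw [inner_qrColumn_of_lt B, mul_zero]
    rw [not_le] at h
    simpa using Fin.rev_lt_rev.2 h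

@[simp]
lemma length_leafOf (x : Fin m → Fin Q) : (leafOf x).length = m := by simp [leafOf]

lemma paddedLabels_of_lt (x : Fin m → Fin Q) {l : ℕ} (w : TreeNode Q) (j : Fin m)
    (hj : (j.rev : ℕ) < l) : paddedLabels m ((leafOf x).take l ++ w) j = ((x j : ℕ) : ℝ) := by
  have h1 : (j.rev : ℕ) < ((leafOf x).take l).length := by
    rw [List.length_take, length_leafOf]
    have := j.rev.2
    omega
  rw [paddedLabels, List.getD_eq_getElem _ _ (by rw [List.length_map, List.length_append]; omega),
    List.getElem_map,
    List.getElem_append_left h1, List.getElem_take]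
  simp only [leafOf, List.getElem_ofFn]
  exact congrArg (fun i => ((x i : ℕ) : ℝ)) (Fin.rev_rev j)

lemma paddedLabels_append_cons (x : Fin m → Fin Q) (l : Fin m) (a : Fin Q) (w : TreeNode Q) :
    paddedLabels m ((leafOf x).take l ++ a :: w) l.rev = ((a : ℕ) : ℝ) := by
  have h1 : ((leafOf x).take l).length = l := by
    rw [List.length_take, length_leafOf]
    omega
  have h2 : (l.rev.rev : ℕ) = l := by rw [Fin.rev_rev]
  rw [paddedLabels, List.getD_eq_getElem _ _ (by
    rw [List.length_map, List.length_append, List.length_cons]; omega), List.getElem_map,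
    List.getElem_append_right (by omega)]
  simp [h1]

lemma nodeCost_take_leafOf (b : ℝ) (x : Fin m → Fin Q) (ζ : EuclideanSpace ℝ (Fin n))
    {u : Fin n → ℝ} (hu : WithLp.toLp 2 u = ∑ j, ((x j : ℕ) : ℝ) • euclideanColumn B j + ζ)
    {j : ℕ} (hj : j ≤ m) :
    nodeCost b (treeMatrix B) (treeVector B u) ((leafOf x).take j) =
      (∑ i ∈ Finset.univ.filter (fun i : Fin m => (i : ℕ) < j),
        inner ℝ (qrColumn B i.rev) ζ ^ 2) - b * j := by
  have hlen : ((leafOf x).take j).length = j := by rw [List.length_take, length_leafOf]; omega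
  rw [nodeCost, hlen]
  congr 1
  refine Finset.sum_congr rfl fun i hi => ?_
  rw [edgeWeight_eq B _ ζ _ i hu, inner_qrColumn_sum_eq_zero, add_zero]
  intro j' hj'
  have hi' : (i : ℕ) < j := by simpa using hi
  have := paddedLabels_of_lt x [] j' (l := j) (lt_of_le_of_lt (Fin.le_def.1 hj') hi')
  rw [List.append_nil] at this
  rw [this, sub_self]

/-- If a node off the path to the transmitted leaf, branching at level `l`, costs at most as much as
a node at level `j` of that path, then the noise components from level `l` on have to be large
compared with the distance caused by the wrong labels. This is the exponential form of that
comparison. -/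
lemma one_le_exp_of_nodeCost_le (b : ℝ) (x : Fin m → Fin Q) (ζ : EuclideanSpace ℝ (Fin n))
    {u : Fin n → ℝ} (hu : WithLp.toLp 2 u = ∑ j, ((x j : ℕ) : ℝ) • euclideanColumn B j + ζ)
    {l : Fin m} {a : Fin Q} {w : TreeNode Q} {k j : ℕ} (hk : w.length = k)
    (hj : j ≤ m) (hlj : l < j)
    (hle : nodeCost b (treeMatrix B) (treeVector B u) ((leafOf x).take l ++ a :: w) ≤
      nodeCost b (treeMatrix B) (treeVector B u) ((leafOf x).take j)) :
    1 ≤ Real.exp ((1 / 4) * ∑ i ∈ Finset.univ.filter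
            (fun i : Fin m => (l : ℕ) ≤ i ∧ (i : ℕ) < max (l + (k + 1)) j),
          inner ℝ (qrColumn B i.rev) ζ ^ 2) *
        Real.exp (b / 8 * ((k + 1 : ℕ) - (j - l : ℕ) : ℝ)) *
        Real.exp (-(1 / 16) * ∑ i ∈ Finset.univ.filter (fun i : Fin m => (i : ℕ) < l + (k + 1)),
          inner ℝ (qrColumn B i.rev)
          (∑ j, (((x j : ℕ) : ℝ) - paddedLabels m ((leafOf x).take l ++ a :: w) j) •
            euclideanColumn B j) ^ 2) := by
  have hlen : ((leafOf x).take l ++ a :: w).length = l + (k + 1) := by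
    rw [List.length_append, List.length_take, length_leafOf, List.length_cons, hk]; omega
  rw [nodeCost_take_leafOf B b x ζ hu hj, nodeCost, hlen] at hle
  simp only [edgeWeight_eq B _ ζ _ _ hu] at hle
  set z : Fin m → ℝ := fun i => inner ℝ (qrColumn B i.rev) ζ with hz
  set A : Fin m → ℝ := fun i => inner ℝ (qrColumn B i.rev)
          (∑ j, (((x j : ℕ) : ℝ) - paddedLabels m ((leafOf x).take l ++ a :: w) j) •
            euclideanColumn B j) with hA
  have hA0 : ∀ i : Fin m, (i : ℕ) < l → A i = 0 := by
    intro i hi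
    refine inner_qrColumn_sum_eq_zero B _ i fun j' hj' => ?_
    rw [paddedLabels_of_lt x (a :: w) j' (lt_of_le_of_lt (Fin.le_def.1 hj') hi), sub_self]
  set lt : ℕ → Finset (Fin m) := fun t => Finset.univ.filter fun i => (i : ℕ) < t with hlt
  set win : ℕ → Finset (Fin m) := fun t =>
    Finset.univ.filter fun i => (l : ℕ) ≤ i ∧ (i : ℕ) < t with hwin
  have hsplit : ∀ (F : Fin m → ℝ) (t : ℕ), (l : ℕ) ≤ t → ∑ i ∈ lt t, F i =
      (∑ i ∈ lt l, F i) + ∑ i ∈ win t, F i := by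
    intro F t ht
    rw [← Finset.sum_filter_add_sum_filter_not _ (fun i : Fin m => (i : ℕ) < l),
      Finset.filter_filter, Finset.filter_filter]
    congr 2 <;> ext i <;> simp [hlt, hwin] <;> omega
  have hmono : ∀ t, t ≤ max (l + (k + 1)) j →
      ∑ i ∈ win t, z i ^ 2 ≤ ∑ i ∈ win (max (l + (k + 1)) j), z i ^ 2 := by
    intro t ht
    refine Finset.sum_le_sum_of_subset_of_nonneg (fun i hi => ?_) fun i _ _ => sq_nonneg _
    simp only [hwin, Finset.mem_filter, Finset.mem_univ, true_and] at hi ⊢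
    exact ⟨hi.1, hi.2.trans_le ht⟩
  have h1 := hsplit (fun i => (z i + A i) ^ 2) (l + (k + 1)) (by omega)
  have h2 := hsplit (fun i => z i ^ 2) j hlj.le
  have h3 := hsplit (fun i => A i ^ 2) (l + (k + 1)) (by omega)
  have h4 : ∑ i ∈ lt l, (z i + A i) ^ 2 = ∑ i ∈ lt l, z i ^ 2 :=
    Finset.sum_congr rfl fun i hi => by rw [hA0 i (by simpa [hlt] using hi), add_zero]
  have h5 : ∑ i ∈ lt l, A i ^ 2 = 0 :=
    Finset.sum_eq_zero fun i hi => by rw [hA0 i (by simpa [hlt] using hi)]; norm_num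
  have h6 : (1 / 2) * ∑ i ∈ win (l + (k + 1)), A i ^ 2 ≤
      (∑ i ∈ win (l + (k + 1)), (z i + A i) ^ 2) + ∑ i ∈ win (l + (k + 1)), z i ^ 2 := by
    rw [Finset.mul_sum, ← Finset.sum_add_distrib]
    refine Finset.sum_le_sum fun i _ => ?_
    nlinarith [sq_nonneg (2 * z i + A i)]
  have h7 := hmono (l + (k + 1)) (le_max_left _ _)
  have h8 := hmono j (le_max_right _ _)
  rw [← Real.exp_add, ← Real.exp_add]
  refine Real.one_le_exp ?_
  rw [Nat.cast_sub hlj.le, h3, h5]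
  rw [h1, h2, h4] at hle
  push_cast at hle ⊢
  linarith

end Cost

/-! ### The real model -/

/-- The scalar relating the matrix of the real model to the complex channel matrix. -/
noncomputable def modelScale (Q M : ℕ) (ρ : ℝ) : ℝ := √2 * √(ρ / M) * qamScale Q

lemma combinedMatrix_eq {N M : ℕ} (Q : ℕ) (ρ : ℝ) (H : Fin N → Fin M → ℂ) :
    combinedMatrix Q ρ H = modelScale Q M ρ • realMat H := by
  rw [combinedMatrix, realChannel, Matrix.mul_smul, Matrix.mul_one, smul_smul, modelScale]
  congr 1; ring

lemma euclideanColumn_combinedMatrix {N M : ℕ} (Q : ℕ) (ρ : ℝ) (H : Fin N → Fin M → ℂ) :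
    euclideanColumn (combinedMatrix Q ρ H) = fun j => modelScale Q M ρ • realColumn H j := by
  funext j
  rw [combinedMatrix_eq]
  rfl

lemma realVec_sum_mul {N M : ℕ} (H : Fin N → Fin M → ℂ) (c : Fin M → ℂ) :
    realVec (fun i => ∑ j, H i j * c j) = (realMat H).mulVec (realVec c) := by
  funext l
  refine Fin.addCases (fun i => ?_) (fun i => ?_) l
  · simp only [realVec, Fin.append_left, Matrix.mulVec, dotProduct, Fin.sum_univ_add,
      Fin.append_right, realMat, Matrix.reindex_apply, Matrix.submatrix_apply,
      finSumFinEquiv_symm_apply_natAdd, finSumFinEquiv_symm_apply_castAdd]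
    simp [Finset.sum_add_distrib, sub_eq_add_neg]
  · simp only [realVec, Fin.append_left, Matrix.mulVec, dotProduct, Fin.sum_univ_add,
      Fin.append_right, realMat, Matrix.reindex_apply, Matrix.submatrix_apply,
      finSumFinEquiv_symm_apply_natAdd, finSumFinEquiv_symm_apply_castAdd]
    simp [Finset.sum_add_distrib, add_comm]

lemma realVec_transmitted {Q M : ℕ} (x : Fin (M + M) → Fin Q) :
    realVec (transmitted x) = fun j => qamScale Q * ((x j : ℕ) : ℝ) + qamOffset Q := by
  funext j
  refine Fin.addCases (fun i => ?_) (fun i => ?_) j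
  · simp only [realVec, Fin.append_left, transmitted, qamPoint]
  · simp only [realVec, Fin.append_right, transmitted, qamPoint]

lemma toLp_centredReceived {Q M N : ℕ} (ρ : ℝ) (H : Fin N → Fin M → ℂ) (z : Fin N → ℂ)
    (x : Fin (M + M) → Fin Q) :
    WithLp.toLp 2 (centredReceived ρ H z x) =
      ∑ j, ((x j : ℕ) : ℝ) • euclideanColumn (combinedMatrix Q ρ H) j +
        √2 • WithLp.toLp 2 (realVec z) := by
  have h1 : realVec (received ρ H z x) =
      √(ρ / M) • (realMat H).mulVec (realVec (transmitted x)) + realVec z := by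
    rw [← realVec_sum_mul]
    funext l
    refine Fin.addCases (fun i => ?_) (fun i => ?_) l
    · simp only [realVec, Fin.append_left, received, Pi.add_apply, Pi.smul_apply]
      simp
    · simp only [realVec, Fin.append_right, received, Pi.add_apply, Pi.smul_apply]
      simp
  ext l
  rw [centredReceived, h1, realVec_transmitted, realChannel]
  simp only [PiLp.add_apply, WithLp.ofLp_sum, Finset.sum_apply, PiLp.smul_apply, Pi.sub_apply,
    Pi.smul_apply, Pi.add_apply, Matrix.mulVec, dotProduct, euclideanColumn, combinedMatrix_eq,
    modelScale, Matrix.smul_apply, smul_eq_mul, mul_add, Finset.sum_add_distrib, Finset.mul_sum]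
  rw [add_sub_right_comm, ← Finset.sum_add_distrib, ← Finset.sum_sub_distrib]
  congr 1
  refine Finset.sum_congr rfl fun j _ => ?_
  ring

/-! ### Averaging over the noise and the channel -/

lemma measurable_gramSchmidt {α : Type*} [MeasurableSpace α] {n m : ℕ}
    {f : α → Fin m → EuclideanSpace ℝ (Fin n)} (hf : ∀ j, Measurable fun a => f a j) (i : Fin m) :
    Measurable fun a => InnerProductSpace.gramSchmidt ℝ (f a) i := by
  induction i using WellFoundedLT.induction with
  | ind i ih =>
    have h : ∀ a, InnerProductSpace.gramSchmidt ℝ (f a) i = f a i - ∑ j ∈ Finset.Iio i,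
        (ℝ ∙ InnerProductSpace.gramSchmidt ℝ (f a) j).starProjection (f a i) :=
      fun a => InnerProductSpace.gramSchmidt_def ℝ (f a) i
    simp only [h, Submodule.starProjection_singleton]
    refine (hf i).sub (Finset.measurable_sum _ fun j hj => ?_)
    have := ih j (Finset.mem_Iio.1 hj)
    have := hf i
    simp only [RCLike.ofReal_real_eq_id, id]
    fun_prop

lemma measurable_gramSchmidtNormed {α : Type*} [MeasurableSpace α] {n m : ℕ}
    {f : α → Fin m → EuclideanSpace ℝ (Fin n)} (hf : ∀ j, Measurable fun a => f a j) (i : Fin m) :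
    Measurable fun a => InnerProductSpace.gramSchmidtNormed ℝ (f a) i := by
  have := measurable_gramSchmidt hf i
  simp only [InnerProductSpace.gramSchmidtNormed]
  simp only [RCLike.ofReal_real_eq_id, id]
  fun_prop

lemma measurable_realColumn {N M : ℕ} (j : Fin (M + M)) :
    Measurable fun H : Fin N → Fin M → ℂ => realColumn H j := by
  refine Fin.addCases (fun t => ?_) (fun t => ?_) j
  · simp only [realColumn_castAdd]; fun_prop
  · simp only [realColumn_natAdd]; fun_prop

lemma lintegral_exp_sum_inner_qrColumn_sq_le {N m : ℕ} (B : Matrix (Fin (N + N)) (Fin m) ℝ)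
    (W : Finset (Fin m)) :
    ∫⁻ z, ENNReal.ofReal (Real.exp ((1 / 4) * ∑ i ∈ W,
      inner ℝ (qrColumn B i.rev) (√2 • WithLp.toLp 2 (realVec z)) ^ 2)) ∂noiseLaw N ≤
      ENNReal.ofReal (√2 ^ W.card) := by
  classical
  set W' := W.filter fun i => qrColumn B i.rev ≠ 0 with hW'
  have ho : Orthonormal ℝ fun i : W' => qrColumn B (i : Fin m).rev := by
    refine ⟨fun i => ?_, fun i j hij => ?_⟩
    · exact InnerProductSpace.gramSchmidtNormed_unit_length' (Finset.mem_filter.1 i.2).2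
    · exact inner_gramSchmidtNormed_of_ne _ fun h => hij (Subtype.ext (Fin.rev_injective h))
  have h1 : ∀ z : Fin N → ℂ, (1 / 4) * ∑ i ∈ W,
      inner ℝ (qrColumn B i.rev) (√2 • WithLp.toLp 2 (realVec z)) ^ 2 =
      (∑ i : W', inner ℝ (qrColumn B (i : Fin m).rev)
        (WithLp.toLp 2 (realVec fun n => 1 * z n)) ^ 2) / 2 := by
    intro z
    have h2 : ∑ i ∈ W, inner ℝ (qrColumn B i.rev) (√2 • WithLp.toLp 2 (realVec z)) ^ 2 =
        ∑ i ∈ W', inner ℝ (qrColumn B i.rev) (√2 • WithLp.toLp 2 (realVec z)) ^ 2 := by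
      refine (Finset.sum_subset (Finset.filter_subset _ _) fun i hi hi' => ?_).symm
      have : qrColumn B i.rev = 0 := by simpa [hW', hi] using hi'
      rw [this, inner_zero_left]; norm_num
    rw [h2, ← Finset.sum_coe_sort W' fun i =>
      inner ℝ (qrColumn B i.rev) (√2 • WithLp.toLp 2 (realVec z)) ^ 2, Finset.mul_sum,
      Finset.sum_div]
    refine Finset.sum_congr rfl fun i _ => ?_
    rw [inner_smul_right, mul_pow, Real.sq_sqrt (by norm_num)]
    simp only [one_mul]
    ring
  simp only [h1]
  rw [lintegral_exp_sum_sq_noiseLaw ho (by simp), ← ENNReal.ofReal_pow (by positivity)]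
  refine ENNReal.ofReal_le_ofReal (pow_le_pow_right₀ (Real.one_le_sqrt.2 (by norm_num)) ?_)
  rw [Fintype.card_coe]
  exact Finset.card_filter_le _ _

lemma card_filter_window_le (m l t : ℕ) :
    (Finset.univ.filter fun i : Fin m => l ≤ (i : ℕ) ∧ (i : ℕ) < t).card ≤ t - l := by
  rw [← Nat.card_Ico]
  exact Finset.card_le_card_of_injOn (fun i => (i : ℕ)) (fun i hi => by simpa using hi)
    fun i _ j _ h => Fin.ext h

/-- With bias at least `16` the nodes of the transmitted path cost geometrically less with their
depth. -/
lemma sum_pow_mul_exp_le {b : ℝ} (hb : 16 ≤ b) (l m k : ℕ) :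
    ∑ j ∈ Finset.Ioc l m, √2 ^ ((k + 1) + (j - l)) *
      Real.exp (b / 8 * ((k + 1 : ℕ) - (j - l : ℕ) : ℝ)) ≤ (√2 * Real.exp (b / 8)) ^ (k + 1) := by
  have hr : √2 * Real.exp (-(b / 8)) ≤ 1 / 2 := by
    have h1 : √2 ≤ 3 / 2 := Real.sqrt_le_iff.2 ⟨by norm_num, by norm_num⟩
    have h2 : (3 : ℝ) ≤ Real.exp (b / 8) := by
      have := Real.add_one_le_exp (b / 8)
      linarith
    rw [Real.exp_neg]
    rw [mul_inv_le_iff₀ (Real.exp_pos _)]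
    linarith
  have hterm : ∀ j ∈ Finset.Ioc l m, √2 ^ ((k + 1) + (j - l)) *
      Real.exp (b / 8 * ((k + 1 : ℕ) - (j - l : ℕ) : ℝ)) ≤
      (√2 * Real.exp (b / 8)) ^ (k + 1) * (1 / 2) ^ (j - l) := by
    intro j _
    have : √2 ^ ((k + 1) + (j - l)) * Real.exp (b / 8 * ((k + 1 : ℕ) - (j - l : ℕ) : ℝ)) =
        (√2 * Real.exp (b / 8)) ^ (k + 1) * (√2 * Real.exp (-(b / 8))) ^ (j - l) := by
      rw [mul_pow, mul_pow, ← Real.exp_nat_mul, ← Real.exp_nat_mul, pow_add, mul_mul_mul_comm,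
        ← Real.exp_add]
      congr 2; ring
    rw [this]
    gcongr
  refine (Finset.sum_le_sum hterm).trans ?_
  rw [← Finset.mul_sum]
  refine mul_le_of_le_one_right (by positivity) ?_
  calc ∑ j ∈ Finset.Ioc l m, (1 / 2 : ℝ) ^ (j - l) ≤
        ∑ i ∈ Finset.range (m - l), (1 / 2 : ℝ) ^ (i + 1) := by
        refine le_of_eq (Finset.sum_nbij' (fun j => j - l - 1) (fun i => i + l + 1) ?_ ?_ ?_ ?_ ?_)
        all_goals simp only [Finset.mem_Ioc, Finset.mem_range]
        all_goals intros
        all_goals first | omega | (congr 1; omega)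
    _ = (1 / 2) * ∑ i ∈ Finset.range (m - l), (1 / 2 : ℝ) ^ i := by
        rw [Finset.mul_sum]; exact Finset.sum_congr rfl fun i _ => by ring
    _ ≤ 1 := by
        rw [geom_sum_eq (by norm_num)]
        have : (0 : ℝ) ≤ (1 / 2) ^ (m - l) := by positivity
        rw [show ((1 / 2 : ℝ) ^ (m - l) - 1) / (1 / 2 - 1) = 2 - 2 * (1 / 2) ^ (m - l) by ring]
        linarith

/-- The squared distance caused by the wrong labels of a node, in the rows that the node reaches.
The node has the first `l` labels of the transmitted path, then the wrong label `a`, then the `k` labels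
in `w`. -/
noncomputable def errorEnergy {Q M N : ℕ} (ρ : ℝ) (x : Fin (M + M) → Fin Q) (l : Fin (M + M))
    (a : Fin Q) (w : TreeNode Q) (k : ℕ) (H : Fin N → Fin M → ℂ) : ℝ :=
  ∑ i ∈ Finset.univ.filter (fun i : Fin (M + M) => (i : ℕ) < l + (k + 1)),
    inner ℝ (qrColumn (combinedMatrix Q ρ H) i.rev)
      (∑ j, (((x j : ℕ) : ℝ) - paddedLabels (M + M) ((leafOf x).take l ++ a :: w) j) •
        euclideanColumn (combinedMatrix Q ρ H) j) ^ 2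

lemma measurable_errorEnergy {Q M N : ℕ} (ρ : ℝ) (x : Fin (M + M) → Fin Q) (l : Fin (M + M))
    (a : Fin Q) (w : TreeNode Q) (k : ℕ) :
    Measurable (errorEnergy (N := N) ρ x l a w k) := by
  unfold errorEnergy
  simp only [qrColumn_eq, euclideanColumn_combinedMatrix]
  have h1 : ∀ j, Measurable fun H : Fin N → Fin M → ℂ => modelScale Q M ρ • realColumn H j :=
    fun j => by have := measurable_realColumn (N := N) j; fun_prop
  have h2 := fun i => measurable_gramSchmidtNormed h1 i
  refine Finset.measurable_sum _ fun i _ => ?_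
  have h3 : Measurable fun H : Fin N → Fin M → ℂ =>
      ∑ j, (((x j : ℕ) : ℝ) - paddedLabels (M + M) ((leafOf x).take l ++ a :: w) j) •
        modelScale Q M ρ • realColumn H j :=
    Finset.measurable_sum _ fun j _ => by have := h1 j; fun_prop
  exact ((h2 i.rev).inner h3).pow_const 2

lemma lintegral_exp_neg_errorEnergy_le {Q M N : ℕ} (hMN : M ≤ N) {ρ : ℝ}
    (x : Fin (M + M) → Fin Q) (l : Fin (M + M)) {a : Fin Q} (ha : a ≠ x l.rev) (w : TreeNode Q)
    {k : ℕ} (hk : l + (k + 1) ≤ M + M) {s : ℝ} (hs : 1 ≤ s)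
    (hρ : 32 * s ≤ modelScale Q M ρ ^ 2) :
    ∫⁻ H, ENNReal.ofReal (Real.exp (-(1 / 16) * errorEnergy ρ x l a w k H)) ∂channelLaw N M ≤
      ENNReal.ofReal (columnConst * ((2 / s) ^ (1 / 8 : ℝ)) ^ (k + 1)) := by
  set c : Fin (M + M) := (⟨l + k, by omega⟩ : Fin (M + M)).rev with hc
  have hcl : c ≤ l.rev := Fin.rev_le_rev.2 (Fin.le_def.2 (by simp))
  have hck : (c : ℕ) + (k + 1) ≤ M + M := by rw [hc, Fin.val_rev]; simp only; omega
  have hd : 1 ≤ |((x l.rev : ℕ) : ℝ) -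
      paddedLabels (M + M) ((leafOf x).take l ++ a :: w) l.rev| := by
    rw [paddedLabels_append_cons]
    have h1 : ((x l.rev : ℕ) : ℤ) - ((a : ℕ) : ℤ) ≠ 0 := by
      intro h
      exact ha (Fin.ext (by omega))
    exact_mod_cast Int.one_le_abs h1
  refine le_trans (le_of_eq ?_) (lintegral_exp_neg_sum_inner_sq_channelLaw_le hMN hcl
    (fun j => ((x j : ℕ) : ℝ) - paddedLabels (M + M) ((leafOf x).take l ++ a :: w) j) hd hs hρ hck)
  refine lintegral_congr fun H => ?_
  congr 3
  rw [errorEnergy]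
  refine Finset.sum_nbij' Fin.rev Fin.rev ?_ ?_ ?_ ?_ ?_
  · intro i hi
    rw [Finset.mem_Ici, hc]
    have : (i : ℕ) < l + (k + 1) := by simpa using hi
    exact Fin.rev_le_rev.2 (Fin.le_def.2 (by simp only; omega))
  · intro i hi
    rw [Finset.mem_Ici, hc] at hi
    have h1 : (i.rev : ℕ) ≤ l + k := by
      have := Fin.rev_le_rev.2 hi
      rw [Fin.rev_rev] at this
      exact this
    simp only [Finset.mem_filter, Finset.mem_univ, true_and]
    omega
  · intro i _; exact Fin.rev_rev i
  · intro i _; exact Fin.rev_rev i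
  · intro i _
    rw [qrColumn_eq, euclideanColumn_combinedMatrix]

/-- An upper bound for the indicator that a node off the transmitted path is generated, as a sum
over the levels `j` of that path. Parameters as for `errorEnergy`. -/
noncomputable def generationBound {Q M N : ℕ} (ρ b : ℝ) (x : Fin (M + M) → Fin Q)
    (l : Fin (M + M)) (a : Fin Q) (w : TreeNode Q) (k : ℕ) (H : Fin N → Fin M → ℂ)
    (z : Fin N → ℂ) : ℝ≥0∞ :=
  ∑ j ∈ Finset.Ioc (l : ℕ) (M + M),
    ENNReal.ofReal (Real.exp ((1 / 4) * ∑ i ∈ Finset.univ.filter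
        (fun i : Fin (M + M) => (l : ℕ) ≤ i ∧ (i : ℕ) < max (l + (k + 1)) j),
        inner ℝ (qrColumn (combinedMatrix Q ρ H) i.rev)
          (√2 • WithLp.toLp 2 (realVec z)) ^ 2)) *
      ENNReal.ofReal (Real.exp (b / 8 * ((k + 1 : ℕ) - (j - (l : ℕ) : ℕ) : ℝ))) *
      ENNReal.ofReal (Real.exp (-(1 / 16) * errorEnergy ρ x l a w k H))

lemma measurable_generationBound {Q M N : ℕ} (ρ b : ℝ) (x : Fin (M + M) → Fin Q)
    (l : Fin (M + M)) (a : Fin Q) (w : TreeNode Q) (k : ℕ) (H : Fin N → Fin M → ℂ) :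
    Measurable (generationBound ρ b x l a w k H) := by
  unfold generationBound
  simp only [inner_smul_right, inner_realVec]
  fun_prop

lemma one_le_generationBound {Q M N : ℕ} (ρ b : ℝ) (x : Fin (M + M) → Fin Q)
    (l : Fin (M + M)) {a : Fin Q} (ha : a ≠ x l.rev) {w : TreeNode Q} {k : ℕ} (hk : w.length = k)
    (H : Fin N → Fin M → ℂ) (z : Fin N → ℂ)
    (hp : (leafOf x).take l ++ a :: w ∈ generatedNodes (M + M) (nodeCost (Q := Q) b
      (treeMatrix (combinedMatrix Q ρ H))
      (treeVector (combinedMatrix Q ρ H) (centredReceived ρ H z x)))) :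
    1 ≤ generationBound ρ b x l a w k H z := by
  have hx : (leafOf x)[(l : ℕ)]? ≠ some a := by
    rw [List.getElem?_eq_getElem (by simp)]
    simpa [leafOf] using ha.symm
  obtain ⟨j, hlj, hjm, hle⟩ := exists_cost_le_of_mem_generatedNodes (length_leafOf x) l.2 hx hp
  have h1 := one_le_exp_of_nodeCost_le (combinedMatrix Q ρ H) b x _
    (toLp_centredReceived ρ H z x) hk hjm hlj hle
  rw [generationBound]
  refine le_trans ?_ (Finset.single_le_sum (fun _ _ => zero_le) (Finset.mem_Ioc.2 ⟨hlj, hjm⟩))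
  rw [← ENNReal.ofReal_mul (by positivity), ← ENNReal.ofReal_mul (by positivity),
    ← ENNReal.ofReal_one]
  exact ENNReal.ofReal_le_ofReal h1

lemma lintegral_generationBound_le {Q M N : ℕ} (ρ : ℝ) {b : ℝ} (hb : 16 ≤ b)
    (x : Fin (M + M) → Fin Q) (l : Fin (M + M)) (a : Fin Q) (w : TreeNode Q) (k : ℕ)
    (H : Fin N → Fin M → ℂ) :
    ∫⁻ z, generationBound ρ b x l a w k H z ∂noiseLaw N ≤
      ENNReal.ofReal ((√2 * Real.exp (b / 8)) ^ (k + 1)) *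
        ENNReal.ofReal (Real.exp (-(1 / 16) * errorEnergy ρ x l a w k H)) := by
  unfold generationBound
  have hm : ∀ j : ℕ, Measurable fun z : Fin N → ℂ => ENNReal.ofReal (Real.exp ((1 / 4) *
      ∑ i ∈ Finset.univ.filter
        (fun i : Fin (M + M) => (l : ℕ) ≤ i ∧ (i : ℕ) < max (l + (k + 1)) j),
        inner ℝ (qrColumn (combinedMatrix Q ρ H) i.rev)
          (√2 • WithLp.toLp 2 (realVec z)) ^ 2)) := by
    intro j
    simp only [inner_smul_right, inner_realVec]
    fun_prop
  rw [lintegral_finsetSum _ fun j _ => ((hm j).mul_const _).mul_const _]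
  calc _ ≤ ∑ j ∈ Finset.Ioc (l : ℕ) (M + M), ENNReal.ofReal (√2 ^ ((k + 1) + (j - l)) *
      Real.exp (b / 8 * ((k + 1 : ℕ) - (j - (l : ℕ) : ℕ) : ℝ))) *
      ENNReal.ofReal (Real.exp (-(1 / 16) * errorEnergy ρ x l a w k H)) := by
        refine Finset.sum_le_sum fun j hj => ?_
        rw [lintegral_mul_const _ ((hm j).mul_const _), lintegral_mul_const _ (hm j),
          ENNReal.ofReal_mul (by positivity)]
        gcongr
        refine (lintegral_exp_sum_inner_qrColumn_sq_le _ _).trans (ENNReal.ofReal_le_ofReal ?_)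
        refine pow_le_pow_right₀ (Real.one_le_sqrt.2 (by norm_num))
          ((card_filter_window_le _ _ _).trans ?_)
        have := (Finset.mem_Ioc.1 hj).1
        rcases max_cases (l + (k + 1)) j with ⟨h, _⟩ | ⟨h, _⟩ <;> rw [h] <;> omega
    _ ≤ _ := by
        rw [← Finset.sum_mul, ← ENNReal.ofReal_sum_of_nonneg fun j _ => by positivity]
        gcongr
        exact sum_pow_mul_exp_le hb _ _ _

/-! ### Counting the generated nodes -/

/-- The nodes branching off a path of length `m`: the level of the branching, the number of labels
after the first wrong one, the first wrong label and the labels after it. -/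
abbrev BranchIndex (Q m : ℕ) : Type := Σ l : Fin m, Σ k : Fin (m - l), Fin Q × (Fin k → Fin Q)

/-- The node at a given branch off the path to the leaf of `x`. -/
def branchNode {Q m : ℕ} (x : Fin m → Fin Q) (i : BranchIndex Q m) : TreeNode Q :=
  (leafOf x).take i.1 ++ i.2.2.1 :: List.ofFn i.2.2.2

lemma eq_take_or_exists_branch {α : Type*} (p y : List α) (h : p.length ≤ y.length) :
    p = y.take p.length ∨ ∃ l a w, l < y.length ∧ y[l]? ≠ some a ∧ p = y.take l ++ a :: w := by
  induction p generalizing y with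
  | nil => left; simp
  | cons a p ih =>
    cases y with
    | nil => simp at h
    | cons c y =>
      by_cases hac : c = a
      · subst hac
        rcases ih y (by simpa using h) with h1 | ⟨l, a', w, hl, ha', h1⟩
        · left; simpa using h1
        · exact Or.inr ⟨l + 1, a', w, by simpa using hl, by simpa using ha', by simpa using h1⟩
      · exact Or.inr ⟨0, a, p, by simp, by simpa using hac, by simp⟩

lemma mem_generatedNodes_cases {Q m : ℕ} (h : TreeNode Q → ℝ) (x : Fin m → Fin Q) {p : TreeNode Q}
    (hp : p ∈ generatedNodes m h) :
    (∃ j ≤ m, p = (leafOf x).take j) ∨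
      ∃ i : BranchIndex Q m, i.2.2.1 ≠ x i.1.rev ∧ p = branchNode x i := by
  have hlen := length_le_of_mem_generatedNodes (length_leafOf x) hp
  rcases eq_take_or_exists_branch p (leafOf x) (by simpa using hlen) with
    h1 | ⟨l, a, w, hl, ha, rfl⟩
  · exact Or.inl ⟨_, hlen, h1⟩
  · right
    rw [length_leafOf] at hl
    have hw : w.length < m - l := by
      rw [List.length_append, List.length_take, length_leafOf, List.length_cons] at hlen
      omega
    refine ⟨⟨⟨l, hl⟩, ⟨w.length, hw⟩, a, fun i => w[i]⟩, ?_, ?_⟩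
    · rw [List.getElem?_eq_getElem (by simpa using hl)] at ha
      simpa [leafOf, eq_comm] using ha
    · simp [branchNode]

open Classical in
/-- The nodes of the transmitted path are counted in full, all others by their indicator. -/
lemma encard_generatedNodes_le {Q m : ℕ} (h : TreeNode Q → ℝ) (x : Fin m → Fin Q) :
    ((generatedNodes m h).encard : ℝ≥0∞) ≤ (m + 1 : ℕ) +
      ∑ i ∈ Finset.univ.filter (fun i : BranchIndex Q m => i.2.2.1 ≠ x i.1.rev),
        if branchNode x i ∈ generatedNodes m h then 1 else 0 := by
  set S := generatedNodes m h
  set I := Finset.univ.filter (fun i : BranchIndex Q m => i.2.2.1 ≠ x i.1.rev) with hI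
  set F₁ := (Finset.range (m + 1)).image fun j => (leafOf x).take j with hF₁
  set F₂ := (I.filter fun i => branchNode x i ∈ S).image (branchNode x) with hF₂
  have hsub : S ⊆ ↑(F₁ ∪ F₂) := by
    intro p hp
    rw [Finset.coe_union]
    rcases mem_generatedNodes_cases h x hp with ⟨j, hj, h1⟩ | ⟨i, hi, rfl⟩
    · left
      rw [hF₁, Finset.mem_coe, Finset.mem_image]
      exact ⟨j, by simpa using Nat.lt_succ_of_le hj, h1.symm⟩
    · right
      rw [hF₂, Finset.mem_coe, Finset.mem_image]
      exact ⟨i, by simpa [hI] using ⟨hi, hp⟩, rfl⟩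
  have hcard : (F₁ ∪ F₂).card ≤ (m + 1) + (I.filter fun i => branchNode x i ∈ S).card :=
    (Finset.card_union_le _ _).trans (add_le_add
      (Finset.card_image_le.trans (by simp)) Finset.card_image_le)
  calc (S.encard : ℝ≥0∞) ≤ (((F₁ ∪ F₂ : Finset (TreeNode Q)) : Set (TreeNode Q)).encard : ℝ≥0∞) :=
        ENat.toENNReal_le.2 (Set.encard_le_encard hsub)
    _ = ((F₁ ∪ F₂).card : ℝ≥0∞) := by rw [Set.encard_coe_eq_coe_finsetCard]; simp
    _ ≤ (((m + 1) + (I.filter fun i => branchNode x i ∈ S).card : ℕ) : ℝ≥0∞) := by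
        exact_mod_cast hcard
    _ = _ := by
        rw [Finset.sum_boole]
        push_cast
        rfl

lemma sum_branchIndex_le {Q m : ℕ} {K φ : ℝ} (hK : 0 ≤ K) (hφ : 0 ≤ φ) (h : Q * φ ≤ 1 / 2)
    (P : BranchIndex Q m → Prop) [DecidablePred P] :
    ∑ i ∈ Finset.univ.filter P, K * φ ^ ((i.2.1 : ℕ) + 1) ≤ m * K := by
  calc _ ≤ ∑ i : BranchIndex Q m, K * φ ^ ((i.2.1 : ℕ) + 1) :=
        Finset.sum_le_sum_of_subset_of_nonneg (Finset.filter_subset _ _)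
          fun i _ _ => by positivity
    _ = ∑ l : Fin m, ∑ k : Fin (m - l), K * (Q * φ) ^ ((k : ℕ) + 1) := by
        rw [Fintype.sum_sigma]
        refine Finset.sum_congr rfl fun l _ => ?_
        rw [Fintype.sum_sigma]
        refine Finset.sum_congr rfl fun k _ => ?_
        simp only [Finset.sum_const, Finset.card_univ, Fintype.card_prod, Fintype.card_fin,
          Fintype.card_pi, Finset.prod_const, nsmul_eq_mul]
        push_cast
        ring
    _ ≤ ∑ _l : Fin m, K := by
        refine Finset.sum_le_sum fun l _ => ?_
        rw [← Finset.mul_sum]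
        refine mul_le_of_le_one_right hK ?_
        calc _ ≤ ∑ k : Fin (m - l), (1 / 2 : ℝ) ^ ((k : ℕ) + 1) :=
              Finset.sum_le_sum fun k _ => pow_le_pow_left₀ (by positivity) h _
          _ = (1 / 2) * ∑ k ∈ Finset.range (m - l), (1 / 2 : ℝ) ^ k := by
              rw [Finset.sum_range, Finset.mul_sum]
              exact Finset.sum_congr rfl fun k _ => by ring
          _ ≤ 1 := by
              rw [geom_sum_eq (by norm_num)]
              have : (0 : ℝ) ≤ (1 / 2) ^ (m - (l : ℕ)) := by positivity
              rw [show ((1 / 2 : ℝ) ^ (m - (l : ℕ)) - 1) / (1 / 2 - 1) =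
                2 - 2 * (1 / 2) ^ (m - (l : ℕ)) by ring]
              linarith
    _ = m * K := by simp

/-! ### The expected complexity -/

/-- Only the dominating functions `T` and `G` have to be measurable, each in one variable; the
information vector takes finitely many values. -/
lemma lintegral_systemLaw_le {Q M N : ℕ} (hQ : 0 < Q)
    (F : (Fin N → Fin M → ℂ) × (Fin N → ℂ) × (Fin (M + M) → Fin Q) → ℝ≥0∞) (K : ℝ≥0∞)
    (T : (Fin (M + M) → Fin Q) → (Fin N → Fin M → ℂ) → (Fin N → ℂ) → ℝ≥0∞)
    (G : (Fin (M + M) → Fin Q) → (Fin N → Fin M → ℂ) → ℝ≥0∞)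
    (hF : ∀ x H z, F (H, z, x) ≤ T x H z) (hT : ∀ x H, Measurable (T x H))
    (hTG : ∀ x H, ∫⁻ z, T x H z ∂noiseLaw N ≤ G x H) (hG : ∀ x, Measurable (G x))
    (hGK : ∀ x, ∫⁻ H, G x H ∂channelLaw N M ≤ K) :
    ∫⁻ ω, F ω ∂systemLaw Q M N ≤ K := by
  have : Nonempty (Fin Q) := ⟨⟨0, hQ⟩⟩
  have : IsProbabilityMeasure (symbolLaw Q (M + M)) :=
    isProbabilityMeasure_uniformOn Set.finite_univ Set.univ_nonempty
  rw [systemLaw]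
  calc _ ≤ ∫⁻ H, ∫⁻ z, ∫⁻ x, F (H, z, x) ∂symbolLaw Q (M + M) ∂noiseLaw N ∂channelLaw N M :=
        (lintegral_prod_le _).trans (lintegral_mono fun H => lintegral_prod_le _)
    _ ≤ ∫⁻ H, ∫⁻ z, ∑ x, T x H z * symbolLaw Q (M + M) {x} ∂noiseLaw N ∂channelLaw N M := by
        gcongr with H z
        rw [lintegral_fintype]
        gcongr with x
        exact hF x H z
    _ ≤ ∫⁻ H, ∑ x, G x H * symbolLaw Q (M + M) {x} ∂channelLaw N M := by
        gcongr with H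
        rw [lintegral_finsetSum _ fun x _ => (hT x H).mul_const _]
        gcongr with x
        rw [lintegral_mul_const _ (hT x H)]
        gcongr
        exact hTG x H
    _ ≤ ∑ x, K * symbolLaw Q (M + M) {x} := by
        rw [lintegral_finsetSum _ fun x _ => (hG x).mul_const _]
        gcongr with x
        rw [lintegral_mul_const _ (hG x)]
        gcongr
        exact hGK x
    _ = K := by
        rw [← lintegral_fintype fun _ => K]
        simp

lemma expectedComplexity_le {Q M N : ℕ} (hQ : 0 < Q) (hMN : M ≤ N) {ρ b s : ℝ} (hb : 16 ≤ b)
    (hs : 1 ≤ s) (hρ : 32 * s ≤ modelScale Q M ρ ^ 2)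
    (hsb : Q * (√2 * Real.exp (b / 8) * (2 / s) ^ (1 / 8 : ℝ)) ≤ 1 / 2) :
    expectedComplexity Q M N ρ b ≤
      (M + M + 1 : ℕ) + ENNReal.ofReal ((M + M : ℕ) * columnConst) := by
  classical
  set I : (Fin (M + M) → Fin Q) → Finset (BranchIndex Q (M + M)) := fun x =>
    Finset.univ.filter fun i => i.2.2.1 ≠ x i.1.rev with hI
  have hG : ∀ (x : Fin (M + M) → Fin Q) (i : BranchIndex Q (M + M)),
      Measurable fun H : Fin N → Fin M → ℂ =>
        ENNReal.ofReal (Real.exp (-(1 / 16) *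
          errorEnergy ρ x i.1 i.2.2.1 (List.ofFn i.2.2.2) i.2.1 H)) := by
    intro x i
    have := measurable_errorEnergy (N := N) ρ x i.1 i.2.2.1 (List.ofFn i.2.2.2) i.2.1
    fun_prop
  refine lintegral_systemLaw_le hQ _ _
    (fun x H z => (M + M + 1 : ℕ) + ∑ i ∈ I x,
      generationBound ρ b x i.1 i.2.2.1 (List.ofFn i.2.2.2) i.2.1 H z)
    (fun x H => (M + M + 1 : ℕ) + ∑ i ∈ I x,
      ENNReal.ofReal ((√2 * Real.exp (b / 8)) ^ ((i.2.1 : ℕ) + 1)) *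
        ENNReal.ofReal (Real.exp (-(1 / 16) *
          errorEnergy ρ x i.1 i.2.2.1 (List.ofFn i.2.2.2) i.2.1 H)))
    (fun x H z => ?_) (fun x H => ?_) (fun x H => ?_) (fun x => ?_) (fun x => ?_)
  · refine (encard_generatedNodes_le _ x).trans ?_
    gcongr with i hi
    split
    · rename_i hmem
      exact one_le_generationBound ρ b x i.1 (Finset.mem_filter.1 hi).2 (by simp) H z hmem
    · exact zero_le
  · exact measurable_const.add
      (Finset.measurable_sum _ fun i _ => measurable_generationBound ρ b x _ _ _ _ H)
  · rw [lintegral_add_left measurable_const, lintegral_finsetSum _ fun i _ =>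
      measurable_generationBound ρ b x _ _ _ _ H]
    simp only [lintegral_const, measure_univ, mul_one]
    gcongr with i hi
    exact lintegral_generationBound_le ρ hb x _ _ _ _ H
  · exact measurable_const.add
      (Finset.measurable_sum _ fun i _ => (hG x i).const_mul _)
  · rw [lintegral_add_left measurable_const, lintegral_finsetSum _ fun i _ =>
      (hG x i).const_mul _]
    simp only [lintegral_const, measure_univ, mul_one]
    gcongr
    calc _ ≤ ∑ i ∈ I x, ENNReal.ofReal (columnConst *
          (√2 * Real.exp (b / 8) * (2 / s) ^ (1 / 8 : ℝ)) ^ ((i.2.1 : ℕ) + 1)) := by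
          refine Finset.sum_le_sum fun i hi => ?_
          rw [lintegral_const_mul _ (hG x i)]
          have hk : (i.1 : ℕ) + ((i.2.1 : ℕ) + 1) ≤ M + M := by
            have h1 := i.1.2
            have h2 := i.2.1.2
            omega
          refine (mul_le_mul_right (lintegral_exp_neg_errorEnergy_le hMN x i.1
            (Finset.mem_filter.1 hi).2 _ hk hs hρ) _).trans (le_of_eq ?_)
          rw [← ENNReal.ofReal_mul (by positivity), mul_pow _ ((2 / s) ^ (1 / 8 : ℝ))]
          congr 1; ring
      _ ≤ _ := by
          have hc := columnConst_nonneg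
          rw [← ENNReal.ofReal_sum_of_nonneg fun i _ => by positivity]
          exact ENNReal.ofReal_le_ofReal
            (sum_branchIndex_le hc (by positivity) hsb _)

lemma modelScale_sq {Q M : ℕ} (hQ : 2 ≤ Q) {ρ : ℝ} (hρ : 0 ≤ ρ) :
    modelScale Q M ρ ^ 2 = 12 * (ρ / M) / ((Q : ℝ) ^ 2 - 1) := by
  have hQ' : (2 : ℝ) ≤ Q := by exact_mod_cast hQ
  have : 0 < (Q : ℝ) ^ 2 - 1 := by nlinarith
  rw [modelScale, qamScale, mul_pow, mul_pow, Real.sq_sqrt (by norm_num),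
    Real.sq_sqrt (by positivity), Real.sq_sqrt (by positivity)]
  ring

theorem theorem4 (Q : ℕ) (hQ : 2 ≤ Q) :
    ∃ b₀ : ℝ, 0 < b₀ ∧ ∀ b : ℝ, b₀ ≤ b →
      ∃ η₀ : ℝ, 0 < η₀ ∧ ∃ C : ℝ, 0 < C ∧
        ∀ M N : ℕ, 1 ≤ M → M ≤ N → ∀ ρ : ℝ, η₀ * (2 * M : ℕ) ≤ ρ →
          expectedComplexity Q M N ρ b / ((2 * M : ℕ) : ℝ≥0∞) ≤ ENNReal.ofReal C := by
  refine ⟨16, by norm_num, fun b hb => ?_⟩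
  have hQ' : (2 : ℝ) ≤ Q := by exact_mod_cast hQ
  -- the per-level decay `(2 / s) ^ (1 / 8)` beats the `Q` children and the bias: it is `1 / L`
  set L : ℝ := 2 * (Q * (√2 * Real.exp (b / 8))) with hL
  have hL1 : 1 ≤ L := by
    have h1 : 1 ≤ √2 := Real.one_le_sqrt.2 (by norm_num)
    have h2 : 1 ≤ Real.exp (b / 8) := Real.one_le_exp (by linarith)
    have h3 : 1 ≤ √2 * Real.exp (b / 8) := one_le_mul_of_one_le_of_one_le h1 h2
    nlinarith
  have hL0 : 0 < L := by linarith
  set s : ℝ := 2 * L ^ 8 with hs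
  have hs1 : 1 ≤ s := by
    have := one_le_pow₀ hL1 (n := 8)
    linarith
  have hθ : (2 / s) ^ (1 / 8 : ℝ) = 1 / L := by
    have : 2 / s = (1 / L) ^ (8 : ℕ) := by rw [hs]; field_simp
    rw [this, ← Real.rpow_natCast, ← Real.rpow_mul (by positivity)]
    norm_num
  have hc := columnConst_nonneg
  refine ⟨2 * s * Q ^ 2, by positivity, 2 + columnConst, by linarith, fun M N hM hMN ρ hρ => ?_⟩
  have hM' : (1 : ℝ) ≤ M := by exact_mod_cast hM
  have hρ0 : 0 ≤ ρ := le_trans (by positivity) hρ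
  have hQ1 : 0 < (Q : ℝ) ^ 2 - 1 := by nlinarith
  have hscale : 32 * s ≤ modelScale Q M ρ ^ 2 := by
    rw [modelScale_sq hQ hρ0, le_div_iff₀ hQ1]
    have h1 : 4 * s * Q ^ 2 ≤ ρ / M := by
      rw [le_div_iff₀ (by linarith)]
      push_cast at hρ
      linarith
    nlinarith [sq_nonneg (Q : ℝ)]
  have hmain := expectedComplexity_le (by omega) hMN hb hs1 hscale
    (by rw [hθ, hL]; apply le_of_eq; field_simp)
  refine ENNReal.div_le_of_le_mul (hmain.trans ?_)
  rw [← ENNReal.ofReal_natCast, ← ENNReal.ofReal_natCast (2 * M),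
    ← ENNReal.ofReal_add (by positivity) (by positivity), ← ENNReal.ofReal_mul (by positivity)]
  refine ENNReal.ofReal_le_ofReal ?_
  push_cast
  nlinarith
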